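/- An $SU(2)$-structure on a smooth 5-manifold $N$ is a quadruplet $(\eta,\omega_1,\omega_2,\omega_3)$ of smooth forms, $\eta$ of degree $1$ and the $\omega_i$ of degree $2$, such that $\omega_i\wedge\omega_j=\delta_{ij}\,v$ for some 4-form $v$ with $v\wedge\eta$ nowhere zero, and such that $\omega_2(X,Y)\ge 0$ whenever $i_X\omega_3=i_Y\omega_1$. It is called balanced if $$d(\omega_1\wedge\eta)=0,\qquad d(\omega_2\wedge\eta)=0,\qquad d(\omega_3\wedge\omega_3)=0. \tag{4}$$ A 5-dimensional compact nilmanifold is a compact quotient $N=\Gamma\backslash G$ of a simply connected nilpotent 5-dimensional Lie group $G$ by a discrete subgroup $\Gamma$; a form on $N$ is invariant if its pullback to $G$ is left-invariant. Proposition. Every 5-dimensional compact nilmanifold $N=\Gamma\backslash G$ has an invariant balanced $SU(2)$-structure, that is, one whose forms $\eta,\omega_1,\omega_2,\omega_3$ are invariant. Moreover, suppose that $e^1,\dots,e^5$ is a basis of the left-invariant 1-forms on $G$ satisfying the structure equations of one of the Lie algebras $(0,0,0,12,14)$, $(0,0,12,13,23)$, $(0,0,12,13,14+23)$ (the tuple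 lists $de^1,\dots,de^5$, where $ij$ stands for $e^{ij}=e^i\wedge e^j$). Then the $e^i$ descend to 1-forms on $N$, and the descended forms $$\eta=e^1,\quad \omega_1=e^{24}+e^{53},\quad \omega_2=e^{25}+e^{34},\quad \omega_3=e^{23}+e^{45}$$ are an invariant balanced $SU(2)$-structure on $N$; in particular they satisfy (4). -/

import Mathlib

open scoped Manifold ContDiff Nat

noncomputable section

/-- The tensor product `α ⊗ β` of two continuous alternating forms:
`(v_1, …, v_{k+l}) ↦ α(v_1, …, v_k) · β(v_{k+1}, …, v_{k+l})`. -/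
def tensorMul {V : Type*} [AddCommGroup V] [Module ℝ V] [TopologicalSpace V] {k l : ℕ}
    (α : V [⋀^Fin k]→L[ℝ] ℝ) (β : V [⋀^Fin l]→L[ℝ] ℝ) :
    ContinuousMultilinearMap ℝ (fun _ : Fin (k + l) => V) ℝ where
  toFun v := α (v ∘ Fin.castAdd l) * β (v ∘ Fin.natAdd k)
  map_update_add' := by
    intro inst m i x y
    obtain rfl := Subsingleton.elim inst (instDecidableEqFin (k + l))
    induction i using Fin.addCases with
    | left i =>
      have h : ∀ z, Function.update m (Fin.castAdd l i) z ∘ Fin.natAdd k = m ∘ Fin.natAdd k :=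
        fun z => funext fun j => Function.update_of_ne
          (fun h => by have := congrArg Fin.val h; simp at this; omega) _ _
      simp only [Function.update_comp_eq_of_injective _ (Fin.castAdd_injective k l), h,
        ContinuousAlternatingMap.map_update_add, add_mul]
    | right j =>
      have h : ∀ z, Function.update m (Fin.natAdd k j) z ∘ Fin.castAdd l = m ∘ Fin.castAdd l :=
        fun z => funext fun i => Function.update_of_ne
          (fun h => by have := congrArg Fin.val h; simp at this; omega) _ _
      simp only [Function.update_comp_eq_of_injective _ (Fin.natAdd_injective l k), h,
        ContinuousAlternatingMap.map_update_add, mul_add]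
  map_update_smul' := by
    intro inst m i c x
    obtain rfl := Subsingleton.elim inst (instDecidableEqFin (k + l))
    induction i using Fin.addCases with
    | left i =>
      have h : ∀ z, Function.update m (Fin.castAdd l i) z ∘ Fin.natAdd k = m ∘ Fin.natAdd k :=
        fun z => funext fun j => Function.update_of_ne
          (fun h => by have := congrArg Fin.val h; simp at this; omega) _ _
      simp only [Function.update_comp_eq_of_injective _ (Fin.castAdd_injective k l), h,
        ContinuousAlternatingMap.map_update_smul, smul_eq_mul, mul_assoc]
    | right j =>
      have h : ∀ z, Function.update m (Fin.natAdd k j) z ∘ Fin.castAdd l = m ∘ Fin.castAdd l :=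
        fun z => funext fun i => Function.update_of_ne
          (fun h => by have := congrArg Fin.val h; simp at this; omega) _ _
      simp only [Function.update_comp_eq_of_injective _ (Fin.natAdd_injective l k), h,
        ContinuousAlternatingMap.map_update_smul, smul_eq_mul, mul_left_comm]
  cont := (α.cont.comp (continuous_pi fun _ => continuous_apply _)).mul
    (β.cont.comp (continuous_pi fun _ => continuous_apply _))

/-- The wedge product of two continuous alternating forms, in the determinant normalization:
`(α ∧ β)(v) = 1/(k! l!) ∑ σ, sign σ · α(v_{σ 1}, …, v_{σ k}) · β(v_{σ (k+1)}, …, v_{σ (k+l)})`,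
so that `(a ∧ b)(X, Y) = a(X) b(Y) - a(Y) b(X)` for one-forms. -/
def wedge {V : Type*} [AddCommGroup V] [Module ℝ V] [TopologicalSpace V] {k l : ℕ}
    (α : V [⋀^Fin k]→L[ℝ] ℝ) (β : V [⋀^Fin l]→L[ℝ] ℝ) : V [⋀^Fin (k + l)]→L[ℝ] ℝ :=
  ((k ! : ℝ) * (l ! : ℝ))⁻¹ • ContinuousMultilinearMap.alternatization (tensorMul α β)

/-- The model space of 5-manifolds. -/
abbrev E5 : Type := EuclideanSpace ℝ (Fin 5)

/-- A (not necessarily smooth) differential `k`-form on a 5-manifold `M`. -/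
abbrev MForm (M : Type*) [TopologicalSpace M] [ChartedSpace E5 M] (k : ℕ) : Type _ :=
  ∀ x : M, TangentSpace (𝓡 5) x [⋀^Fin k]→L[ℝ] ℝ

/-- Pointwise wedge product of differential forms. -/
def MForm.wedge {M : Type*} [TopologicalSpace M] [ChartedSpace E5 M] {k l : ℕ}
    (α : MForm M k) (β : MForm M l) : MForm M (k + l) :=
  fun x => _root_.wedge (α x) (β x)

/-- Pullback `f^* α` of a differential form along a map. -/
def MForm.pullback {M N : Type*} [TopologicalSpace M] [ChartedSpace E5 M]
    [TopologicalSpace N] [ChartedSpace E5 N] {k : ℕ} (f : M → N) (α : MForm N k) : MForm M k :=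
  fun x => (α (f x)).compContinuousLinearMap (mfderiv (𝓡 5) (𝓡 5) f x)

/-- The expression of a differential form in the preferred chart at `x₀`: its pullback along the
inverse of that chart (meaningful on the target of the chart, which is open in `ℝ⁵`). -/
def MForm.inChart {M : Type*} [TopologicalSpace M] [ChartedSpace E5 M] {k : ℕ}
    (α : MForm M k) (x₀ : M) : E5 → E5 [⋀^Fin k]→L[ℝ] ℝ :=
  fun y => (α ((extChartAt (𝓡 5) x₀).symm y)).compContinuousLinearMap
    (mfderiv (𝓡 5) (𝓡 5) (extChartAt (𝓡 5) x₀).symm y)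

/-- A differential form is smooth if its expressions in the charts are. -/
def MForm.IsSmooth {M : Type*} [TopologicalSpace M] [ChartedSpace E5 M] {k : ℕ}
    (α : MForm M k) : Prop :=
  ∀ x₀ : M, ContDiffOn ℝ ∞ (α.inChart x₀) (extChartAt (𝓡 5) x₀).target

/-- The exterior derivative: at `x`, pass to the chart at `x`, differentiate there, go back. -/
def MForm.d {M : Type*} [TopologicalSpace M] [ChartedSpace E5 M] {k : ℕ}
    (α : MForm M k) : MForm M (k + 1) :=
  fun x => (extDeriv (α.inChart x) (extChartAt (𝓡 5) x x)).compContinuousLinearMap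
    (mfderiv (𝓡 5) (𝓡 5) (extChartAt (𝓡 5) x) x)

/-- An `SU(2)`-structure on a 5-manifold, given by smooth forms `η`, `w 0 = ω₁`, `w 1 = ω₂`,
`w 2 = ω₃`: `ω_i ∧ ω_j = δ_ij v` with `v ∧ η` nowhere zero, and
`i_X ω₃ = i_Y ω₁` implies `ω₂(X, Y) ≥ 0`. -/
structure IsSU2Structure {M : Type*} [TopologicalSpace M] [ChartedSpace E5 M]
    (η : MForm M 1) (w : Fin 3 → MForm M 2) : Prop where
  smooth_eta : η.IsSmooth
  smooth_omega : ∀ i, (w i).IsSmooth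
  exists_volume : ∃ v : MForm M 4, (∀ i j, (w i).wedge (w j) = if i = j then v else 0) ∧
    ∀ x, v.wedge η x ≠ 0
  nonneg : ∀ (x : M) (X Y : TangentSpace (𝓡 5) x),
    (∀ Z : TangentSpace (𝓡 5) x, w 2 x ![X, Z] = w 0 x ![Y, Z]) → 0 ≤ w 1 x ![X, Y]

/-- A balanced `SU(2)`-structure: `d(ω₁ ∧ η) = 0`, `d(ω₂ ∧ η) = 0`, `d(ω₃ ∧ ω₃) = 0`. -/
structure IsBalancedSU2Structure {M : Type*} [TopologicalSpace M] [ChartedSpace E5 M]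
    (η : MForm M 1) (w : Fin 3 → MForm M 2) : Prop extends IsSU2Structure η w where
  d_omega1_eta : ((w 0).wedge η).d = 0
  d_omega2_eta : ((w 1).wedge η).d = 0
  d_omega3_omega3 : ((w 2).wedge (w 2)).d = 0

/-- A smooth real Lie group is regular enough for Mathlib's Lie algebra of a Lie group. -/
instance instLieGroupMinSmoothness {G : Type*} [TopologicalSpace G] [ChartedSpace E5 G] [Group G]
    [LieGroup (𝓡 5) ∞ G] : LieGroup (𝓡 5) (minSmoothness ℝ 3) G :=
  LieGroup.of_le (n := ∞) (by
    rw [minSmoothness_of_isRCLikeNormedField]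
    exact ENat.LEInfty.out)

/-- A differential form on a Lie group is left-invariant if `L_g^* α = α` for all `g`. -/
def MForm.IsLeftInvariant {G : Type*} [TopologicalSpace G] [ChartedSpace E5 G] [Group G] {k : ℕ}
    (α : MForm G k) : Prop :=
  ∀ g : G, α.pullback (fun h => g * h) = α

/-- `N`, together with the projection `π : G → N`, is the compact nilmanifold `Γ \ G`: the group
`G` is a simply connected nilpotent Lie group (nilpotency is that of its Lie algebra), `Γ` is a
discrete subgroup, `N` is compact, and `π` is a surjective local diffeomorphism whose fibres are
the cosets `Γ g`. -/
structure IsCompactNilmanifold {G : Type*} [TopologicalSpace G] [ChartedSpace E5 G] [Group G]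
    [LieGroup (𝓡 5) ∞ G] {N : Type*} [TopologicalSpace N] [ChartedSpace E5 N]
    (Γ : Subgroup G) (π : G → N) : Prop where
  simplyConnected : SimplyConnectedSpace G
  nilpotent : LieRing.IsNilpotent (GroupLieAlgebra (𝓡 5) G)
  discrete : DiscreteTopology Γ
  compact : CompactSpace N
  isLocalDiffeomorph : IsLocalDiffeomorph (𝓡 5) (𝓡 5) ∞ π
  surjective : Function.Surjective π
  fibre : ∀ g h : G, π g = π h ↔ ∃ γ ∈ Γ, h = γ * g

/-- A form on `N = Γ \ G` is invariant if it is induced by a left-invariant form on `G`. -/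
def MForm.IsInvariant {G N : Type*} [TopologicalSpace G] [ChartedSpace E5 G] [Group G]
    [TopologicalSpace N] [ChartedSpace E5 N] {k : ℕ} (π : G → N) (α : MForm N k) : Prop :=
  (α.pullback π).IsLeftInvariant

/-- The form `η = e¹` of the standard quadruplet; the forms `e¹, …, e⁵` are `e 0, …, e 4`. -/
def stdEta {M : Type*} [TopologicalSpace M] [ChartedSpace E5 M] (e : Fin 5 → MForm M 1) :
    MForm M 1 :=
  e 0

/-- `ω₁ = e²⁴ + e⁵³`, `ω₂ = e²⁵ + e³⁴`, `ω₃ = e²³ + e⁴⁵`. -/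
def stdOmega {M : Type*} [TopologicalSpace M] [ChartedSpace E5 M] (e : Fin 5 → MForm M 1) :
    Fin 3 → MForm M 2 :=
  ![(e 1).wedge (e 3) + (e 4).wedge (e 2),
    (e 1).wedge (e 4) + (e 2).wedge (e 3),
    (e 1).wedge (e 2) + (e 3).wedge (e 4)]

/-- A basis `e¹, …, e⁵` of the space of left-invariant one-forms on `G`, that is, of the dual of
the Lie algebra. -/
structure IsLeftInvariantCoframe {G : Type*} [TopologicalSpace G] [ChartedSpace E5 G] [Group G]
    (e : Fin 5 → MForm G 1) : Prop where
  leftInvariant : ∀ i, (e i).IsLeftInvariant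
  linearIndependent : LinearIndependent ℝ (fun i => e i 1)

/-- The structure equations of the Lie algebra `(0, 0, 0, 12, 14)`. -/
def StructureEquationsA {G : Type*} [TopologicalSpace G] [ChartedSpace E5 G]
    (e : Fin 5 → MForm G 1) : Prop :=
  (e 0).d = 0 ∧ (e 1).d = 0 ∧ (e 2).d = 0 ∧ (e 3).d = (e 0).wedge (e 1) ∧
    (e 4).d = (e 0).wedge (e 3)

/-- The structure equations of the Lie algebra `(0, 0, 12, 13, 23)`. -/
def StructureEquationsB {G : Type*} [TopologicalSpace G] [ChartedSpace E5 G]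
    (e : Fin 5 → MForm G 1) : Prop :=
  (e 0).d = 0 ∧ (e 1).d = 0 ∧ (e 2).d = (e 0).wedge (e 1) ∧ (e 3).d = (e 0).wedge (e 2) ∧
    (e 4).d = (e 1).wedge (e 2)

/-- The structure equations of the Lie algebra `(0, 0, 12, 13, 14 + 23)`. -/
def StructureEquationsC {G : Type*} [TopologicalSpace G] [ChartedSpace E5 G]
    (e : Fin 5 → MForm G 1) : Prop :=
  (e 0).d = 0 ∧ (e 1).d = 0 ∧ (e 2).d = (e 0).wedge (e 1) ∧ (e 3).d = (e 0).wedge (e 2) ∧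
    (e 4).d = (e 0).wedge (e 3) + (e 1).wedge (e 2)

end

/-! No classification of nilpotent Lie algebras is needed: one normal form of the bracket serves all
cases. With indices from 0 as in the code, `exists_adapted_basis` gives a basis X₀, …, X₄ of the Lie
algebra in which X₁, …, X₄ span an ideal containing all brackets, and the only nonzero bracket
inside this ideal is [X₁, X₂] = c X₄. In the dual coframe de⁰ = 0, and modulo e⁰ the only nonzero
differential is de⁴ = -c e¹².

The standard quadruplet is then balanced. Wedging with η = e⁰ leaves only the e¹² part of de⁴, and
e⁴ enters ω₁ and ω₂ through e⁴² and e¹⁴, so the result contains a repeated factor and vanishes.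
Moreover ω₃ ∧ ω₃ = 2e¹²³⁴, whose differential is a multiple of tr(ad X₀) e⁰¹²³⁴, and this trace is
zero by nilpotency. The three listed algebras satisfy the same relations in the given coframe
(`isAdapted_of_structureEquations`), so `exists_balanced` yields both halves of the theorem.

To find the basis, `exists_functional` produces a codimension-one ideal containing the derived
algebra whose centre contains a plane. A four-dimensional nilpotent algebra with such a plane has at
most one independent bracket, and this bracket lies in the plane.

The analytic side is a reduction to the identity of G. Left-invariant forms are automatically
smooth, d commutes with pullback, the Chevalley–Eilenberg formula `IsLeftInvariant.d_one_apply`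
computes d algebraically, and left-invariant forms descend along π. -/

noncomputable section

/-! ### Pullback, smoothness and exterior derivative of forms on 5-manifolds -/

/-- A map into alternating forms on `ℝ⁵` is smooth at a point if its values on constant vectors
are. -/
theorem contDiffAt_alternating_of_apply {E : Type*} [NormedAddCommGroup E] [NormedSpace ℝ E]
    {k : ℕ} {f : E → E5 [⋀^Fin k]→L[ℝ] ℝ} {x : E}
    (h : ∀ v : Fin k → E5, ContDiffAt ℝ ∞ (fun y => f y v) x) : ContDiffAt ℝ ∞ f x := by
  let b := (EuclideanSpace.basisFun (Fin 5) ℝ).toBasis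
  -- Evaluation on tuples of basis vectors embeds the forms in a finite-dimensional coordinate
  -- space; a linear left inverse recovers the form from its smooth coordinates.
  let T : (E5 [⋀^Fin k]→L[ℝ] ℝ) →ₗ[ℝ] ((Fin k → Fin 5) → ℝ) :=
    { toFun := fun α s => α (b ∘ s)
      map_add' := fun _ _ => rfl
      map_smul' := fun _ _ => rfl }
  have hT : LinearMap.ker T = ⊥ := by
    rw [LinearMap.ker_eq_bot']
    intro α hα
    have : α.toAlternatingMap = 0 :=
      Module.Basis.ext_alternating b fun v _ => congrFun hα v
    ext v
    exact congrArg (fun β : E5 [⋀^Fin k]→ₗ[ℝ] ℝ => β v) this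
  obtain ⟨S, hS⟩ := LinearMap.exists_leftInverse_of_injective T hT
  let S' : ((Fin k → Fin 5) → ℝ) →L[ℝ] (E5 [⋀^Fin k]→L[ℝ] ℝ) :=
    ⟨S, LinearMap.continuous_of_finiteDimensional S⟩
  have hf : f = fun y => S' (T (f y)) := by
    funext y
    exact (LinearMap.congr_fun hS (f y)).symm
  rw [hf]
  exact S'.contDiff.contDiffAt.comp x
    (contDiffAt_pi.2 fun s => h (b ∘ s))

/-- The composite is linear in the form and multilinear in the linear map, so its value on fixed
vectors is smooth. -/
theorem ContDiffAt.alternating_compContinuousLinearMap {E : Type*} [NormedAddCommGroup E]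
    [NormedSpace ℝ E] {k : ℕ} {f : E → E5 [⋀^Fin k]→L[ℝ] ℝ} {g : E → E5 →L[ℝ] E5} {x : E}
    (hf : ContDiffAt ℝ ∞ f x) (hg : ContDiffAt ℝ ∞ g x) :
    ContDiffAt ℝ ∞ (fun y => (f y).compContinuousLinearMap (g y)) x := by
  refine contDiffAt_alternating_of_apply fun v => ?_
  have hf' : ContDiffAt ℝ ∞ (fun y => (f y).toContinuousMultilinearMap) x :=
    (ContinuousAlternatingMap.toContinuousMultilinearMapCLM (𝕜 := ℝ) (E := E5) (F := ℝ)
      (ι := Fin k) ℝ).contDiff.contDiffAt.comp x hf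
  have hg' : ContDiffAt ℝ ∞ (fun y =>
      ContinuousMultilinearMap.compContinuousLinearMapContinuousMultilinear ℝ
        (fun _ : Fin k => E5) (fun _ : Fin k => E5) ℝ (fun _ => g y)) x :=
    (ContinuousMultilinearMap.contDiff _).contDiffAt.comp x (contDiffAt_pi.2 fun _ => hg)
  exact (ContinuousMultilinearMap.apply ℝ (fun _ : Fin k => E5) ℝ v).contDiff.contDiffAt.comp x
    (hg'.clm_apply hf')

namespace MForm

variable {M N P : Type*} [TopologicalSpace M] [ChartedSpace E5 M]
  [TopologicalSpace N] [ChartedSpace E5 N] [TopologicalSpace P] [ChartedSpace E5 P] {k l : ℕ}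

theorem pullback_apply (f : M → N) (α : MForm N k) (x : M)
    (v : Fin k → TangentSpace (𝓡 5) x) :
    α.pullback f x v = α (f x) (fun i => mfderiv (𝓡 5) (𝓡 5) f x (v i)) := rfl

/-- All tangent spaces are definitionally `E5`, so values at equal points can be compared without
casts. -/
theorem apply_congr (α : MForm M k) {x y : M} (h : x = y) (v : Fin k → E5) :
    (α x : E5 [⋀^Fin k]→L[ℝ] ℝ) v = (α y : E5 [⋀^Fin k]→L[ℝ] ℝ) v := by
  subst h
  rfl

theorem pullback_congr_of_eventuallyEq {f g : M → N} (α : MForm N k) {x : M}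
    (h : f =ᶠ[nhds x] g) : α.pullback f x = α.pullback g x := by
  ext v
  have hd : (mfderiv (𝓡 5) (𝓡 5) f x : E5 →L[ℝ] E5) = mfderiv (𝓡 5) (𝓡 5) g x := h.mfderiv_eq
  refine (apply_congr α h.eq_of_nhds fun i => (mfderiv (𝓡 5) (𝓡 5) f x : E5 →L[ℝ] E5) (v i)).trans
    ?_
  rw [hd]
  rfl

theorem pullback_comp (f : M → N) (g : N → P) (α : MForm P k) {x : M}
    (hg : MDifferentiableAt (𝓡 5) (𝓡 5) g (f x)) (hf : MDifferentiableAt (𝓡 5) (𝓡 5) f x) :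
    α.pullback (g ∘ f) x = (α.pullback g).pullback f x := by
  ext v
  rw [pullback_apply, mfderiv_comp x hg hf]
  rfl

theorem pullback_congr_left (f : M → N) {α β : MForm N k} {x : M} (h : α (f x) = β (f x)) :
    α.pullback f x = β.pullback f x := by
  ext v
  rw [pullback_apply, h]
  rfl

theorem pullback_id (α : MForm M k) : α.pullback id = α := by
  funext x
  ext v
  rw [pullback_apply, mfderiv_id]
  rfl

theorem inChart_eq_pullback (α : MForm M k) (x₀ : M) (y : E5) :
    α.inChart x₀ y = α.pullback (M := E5) (extChartAt (𝓡 5) x₀).symm y := rfl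

theorem mdifferentiableAt_extChartAt_symm [IsManifold (𝓡 5) ∞ M] {x₀ : M} {y : E5}
    (hy : y ∈ (extChartAt (𝓡 5) x₀).target) :
    MDifferentiableAt (𝓡 5) (𝓡 5) (extChartAt (𝓡 5) x₀).symm y :=
  ((contMDiffOn_extChartAt_symm (n := ∞) x₀).contMDiffAt
    ((isOpen_extChartAt_target x₀).mem_nhds hy)).mdifferentiableAt (by simp)

/-- Near `y`, `f` after the inverse chart equals the inverse chart of the target after the
coordinate expression of `f`. Pullback along `f` thus becomes pullback between open subsets of ℝ⁵.
-/
theorem inChart_eventuallyEq [IsManifold (𝓡 5) ∞ M] [IsManifold (𝓡 5) ∞ N] {f : M → N}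
    {U : Set M} (hU : IsOpen U) (hf : ContMDiffOn (𝓡 5) (𝓡 5) ∞ f U) {α : MForm N k}
    {β : MForm M k} (hβ : ∀ x ∈ U, β x = α.pullback f x) {x₀ : M} {n₀ : N} {y : E5}
    (hy : y ∈ (extChartAt (𝓡 5) x₀).target) (hyU : (extChartAt (𝓡 5) x₀).symm y ∈ U)
    (hn : f ((extChartAt (𝓡 5) x₀).symm y) ∈ (chartAt E5 n₀).source) :
    β.inChart x₀ =ᶠ[nhds y] fun z =>
      (α.inChart n₀ ((extChartAt (𝓡 5) n₀ ∘ f ∘ (extChartAt (𝓡 5) x₀).symm) z)).compContinuousLinearMap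
        (fderiv ℝ (extChartAt (𝓡 5) n₀ ∘ f ∘ (extChartAt (𝓡 5) x₀).symm) z) := by
  set c := (extChartAt (𝓡 5) x₀).symm with hc
  set c' := extChartAt (𝓡 5) n₀ with hc'
  have hcc : ContinuousAt c y := continuousAt_extChartAt_symm'' hy
  have h1 : ∀ᶠ z in nhds y, z ∈ (extChartAt (𝓡 5) x₀).target :=
    (isOpen_extChartAt_target x₀).mem_nhds hy
  have h2 : ∀ᶠ z in nhds y, c z ∈ U := hcc (hU.mem_nhds hyU)
  have hfc : ContinuousAt (f ∘ c) y :=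
    ((hf.continuousOn.continuousAt (hU.mem_nhds hyU)).comp hcc :)
  have h3 : ∀ᶠ z in nhds y, f (c z) ∈ (chartAt E5 n₀).source :=
    hfc ((chartAt E5 n₀).open_source.mem_nhds hn)
  -- The source condition is needed on a neighbourhood of `z`, since the derivatives at `z` depend
  -- on germs.
  filter_upwards [h1, h2, h3.eventually_nhds] with z hz1 hz2 hz3
  have hz3' : f (c z) ∈ (chartAt E5 n₀).source := hz3.self_of_nhds
  have hmf : MDifferentiableAt (𝓡 5) (𝓡 5) f (c z) :=
    (hf.contMDiffAt (hU.mem_nhds hz2)).mdifferentiableAt (by simp)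
  have hmc : MDifferentiableAt (𝓡 5) (𝓡 5) c z := mdifferentiableAt_extChartAt_symm hz1
  have hmd : MDifferentiableAt (𝓡 5) (𝓡 5) c' (f (c z)) := by
    have : IsManifold (𝓡 5) 1 N := IsManifold.of_le (n := ∞) (by simp)
    exact mdifferentiableAt_extChartAt hz3'
  have hmd' : MDifferentiableAt (𝓡 5) (𝓡 5) c'.symm (c' (f (c z))) :=
    mdifferentiableAt_extChartAt_symm (c'.map_source (by rwa [hc', extChartAt_source]))
  have hmu : MDifferentiableAt (𝓡 5) (𝓡 5) (c' ∘ f ∘ c) z := hmd.comp z (hmf.comp z hmc)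
  have e1 : β.inChart x₀ z = α.pullback (M := E5) (f ∘ c) z := by
    rw [inChart_eq_pullback, pullback_comp c f α hmf hmc]
    exact pullback_congr_left _ (hβ _ hz2)
  have e2 : f ∘ c =ᶠ[nhds z] c'.symm ∘ (c' ∘ f ∘ c) := by
    filter_upwards [hz3] with w hw
    exact (c'.left_inv (by rwa [hc', extChartAt_source])).symm
  rw [e1, pullback_congr_of_eventuallyEq α e2, pullback_comp (c' ∘ f ∘ c) c'.symm α hmd' hmu]
  ext v
  rw [pullback_apply, mfderiv_eq_fderiv]
  rfl

theorem contDiffAt_transition [IsManifold (𝓡 5) ∞ M] [IsManifold (𝓡 5) ∞ N] {f : M → N}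
    {U : Set M} (hU : IsOpen U) (hf : ContMDiffOn (𝓡 5) (𝓡 5) ∞ f U) {x₀ : M} {n₀ : N} {y : E5}
    (hy : y ∈ (extChartAt (𝓡 5) x₀).target) (hyU : (extChartAt (𝓡 5) x₀).symm y ∈ U)
    (hn : f ((extChartAt (𝓡 5) x₀).symm y) ∈ (chartAt E5 n₀).source) :
    ContDiffAt ℝ ∞ (extChartAt (𝓡 5) n₀ ∘ f ∘ (extChartAt (𝓡 5) x₀).symm) y := by
  rw [← contMDiffAt_iff_contDiffAt]
  exact (contMDiffAt_extChartAt' hn).comp y ((hf.contMDiffAt (hU.mem_nhds hyU)).comp y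
    ((contMDiffOn_extChartAt_symm (n := ∞) x₀).contMDiffAt
      ((isOpen_extChartAt_target x₀).mem_nhds hy)))

theorem IsSmooth.contDiffAt {α : MForm M k} (hα : α.IsSmooth) {x₀ : M} {y : E5}
    (hy : y ∈ (extChartAt (𝓡 5) x₀).target) : ContDiffAt ℝ ∞ (α.inChart x₀) y :=
  (hα x₀).contDiffAt ((isOpen_extChartAt_target x₀).mem_nhds hy)

/-- A form that is locally the pullback of a smooth form along a smooth map is smooth. -/
theorem IsSmooth.of_locally_pullback [IsManifold (𝓡 5) ∞ M] [IsManifold (𝓡 5) ∞ N]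
    {α : MForm N k} (hα : α.IsSmooth) {β : MForm M k}
    (h : ∀ x : M, ∃ U : Set M, IsOpen U ∧ x ∈ U ∧ ∃ f : M → N,
      ContMDiffOn (𝓡 5) (𝓡 5) ∞ f U ∧ ∀ x ∈ U, β x = α.pullback f x) : β.IsSmooth := by
  intro x₀ y hy
  obtain ⟨U, hU, hxU, f, hf, hβ⟩ := h ((extChartAt (𝓡 5) x₀).symm y)
  set n₀ := f ((extChartAt (𝓡 5) x₀).symm y) with hn₀
  have hn : f ((extChartAt (𝓡 5) x₀).symm y) ∈ (chartAt E5 n₀).source := mem_chart_source _ _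
  have hu := contDiffAt_transition hU hf hy hxU hn
  refine ContDiffAt.contDiffWithinAt
    (ContDiffAt.congr_of_eventuallyEq ?_ (inChart_eventuallyEq hU hf hβ hy hxU hn))
  refine ContDiffAt.alternating_compContinuousLinearMap ?_ (hu.fderiv_right (by simp))
  exact (hα.contDiffAt (mem_extChartAt_target n₀)).comp y hu

/-- The exterior derivative commutes with pullback along a smooth map. -/
theorem d_eq_of_eqOn_pullback [IsManifold (𝓡 5) ∞ M] [IsManifold (𝓡 5) ∞ N]
    {α : MForm N k} (hα : α.IsSmooth) {β : MForm M k} {f : M → N} {U : Set M} (hU : IsOpen U)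
    (hf : ContMDiffOn (𝓡 5) (𝓡 5) ∞ f U) (hβ : ∀ x ∈ U, β x = α.pullback f x) {x : M}
    (hx : x ∈ U) : β.d x = α.d.pullback f x := by
  have hy := mem_extChartAt_target (I := 𝓡 5) x
  have hs := extChartAt_to_inv (I := 𝓡 5) x
  have hxU : (extChartAt (𝓡 5) x).symm (extChartAt (𝓡 5) x x) ∈ U := by rwa [hs]
  have hn : f ((extChartAt (𝓡 5) x).symm (extChartAt (𝓡 5) x x)) ∈
      (chartAt E5 (f x)).source := by
    rw [hs]
    exact mem_chart_source _ _
  have hu := contDiffAt_transition hU hf hy hxU hn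
  have huy : (extChartAt (𝓡 5) (f x) ∘ f ∘ (extChartAt (𝓡 5) x).symm) (extChartAt (𝓡 5) x x) =
      extChartAt (𝓡 5) (f x) (f x) := by
    simp only [Function.comp_apply, hs]
  have M1 : IsManifold (𝓡 5) 1 M := IsManifold.of_le (n := ∞) (by simp)
  have N1 : IsManifold (𝓡 5) 1 N := IsManifold.of_le (n := ∞) (by simp)
  have hmf : MDifferentiableAt (𝓡 5) (𝓡 5) f x :=
    (hf.contMDiffAt (hU.mem_nhds hx)).mdifferentiableAt (by simp)
  have hmd : MDifferentiableAt (𝓡 5) (𝓡 5) (extChartAt (𝓡 5) (f x)) (f x) :=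
    mdifferentiableAt_extChartAt (mem_chart_source _ _)
  have hmc : MDifferentiableAt (𝓡 5) (𝓡 5) (extChartAt (𝓡 5) x) x :=
    mdifferentiableAt_extChartAt (mem_chart_source _ _)
  have hchain : (fderiv ℝ (extChartAt (𝓡 5) (f x) ∘ f ∘ (extChartAt (𝓡 5) x).symm)
        (extChartAt (𝓡 5) x x)).comp (mfderiv (𝓡 5) (𝓡 5) (extChartAt (𝓡 5) x) x) =
      (mfderiv (𝓡 5) (𝓡 5) (extChartAt (𝓡 5) (f x)) (f x)).comp
        (mfderiv (𝓡 5) (𝓡 5) f x) := by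
    rw [← mfderiv_eq_fderiv, ← mfderiv_comp x hmd hmf]
    refine (mfderiv_comp (I' := 𝓡 5) (M' := E5) x
      (hu.differentiableAt (by simp)).mdifferentiableAt hmc).symm.trans ?_
    refine Filter.EventuallyEq.mfderiv_eq ?_
    filter_upwards [extChartAt_source_mem_nhds (I := 𝓡 5) x] with z hz
    simp only [Function.comp_apply, (extChartAt (𝓡 5) x).left_inv hz]
  have hd : extDeriv (β.inChart x) (extChartAt (𝓡 5) x x) =
      (extDeriv (α.inChart (f x)) (extChartAt (𝓡 5) (f x) (f x))).compContinuousLinearMap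
        (fderiv ℝ (extChartAt (𝓡 5) (f x) ∘ f ∘ (extChartAt (𝓡 5) x).symm)
          (extChartAt (𝓡 5) x x)) := by
    rw [(inChart_eventuallyEq hU hf hβ hy hxU hn).extDeriv_eq]
    rw [extDeriv_pullback (r := ∞) _ hu (by simpa using ENat.LEInfty.out), huy]
    rw [huy]
    exact (hα.contDiffAt (mem_extChartAt_target _)).differentiableAt (by simp)
  ext v
  have := fun i => DFunLike.congr_fun hchain (v i)
  change extDeriv (β.inChart x) (extChartAt (𝓡 5) x x) _ = extDeriv (α.inChart (f x)) (extChartAt (𝓡 5) (f x) (f x)) _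
  rw [hd]
  exact congrArg (extDeriv (α.inChart (f x)) (extChartAt (𝓡 5) (f x) (f x))) (funext this)

end MForm

end

/-! ### Left-invariant forms and the Chevalley–Eilenberg formula -/

noncomputable section

namespace MForm

section

variable {M : Type*} [TopologicalSpace M] [ChartedSpace E5 M] [IsManifold (𝓡 5) ∞ M] {k : ℕ}

/-- At its own base point the preferred chart has identity derivative, so passing to the chart
changes nothing there. -/
theorem inChart_self (α : MForm M k) (x : M) (v : Fin k → E5) :
    α.inChart x (extChartAt (𝓡 5) x x) v = α x v := by
  have M1 : IsManifold (𝓡 5) 1 M := IsManifold.of_le (n := ∞) (by simp)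
  have h := mfderivWithin_range_extChartAt_symm (I := 𝓡 5) (x := x)
  rw [ModelWithCorners.range_eq_univ, mfderivWithin_univ] at h
  refine Eq.trans ?_ (apply_congr α (extChartAt_to_inv (I := 𝓡 5) x) v)
  exact congrArg (α ((extChartAt (𝓡 5) x).symm (extChartAt (𝓡 5) x x)))
    (funext fun i => DFunLike.congr_fun h (v i))

theorem d_apply (α : MForm M k) (x : M) (v : Fin (k + 1) → E5) :
    α.d x v = extDeriv (α.inChart x) (extChartAt (𝓡 5) x x) v := by
  have M1 : IsManifold (𝓡 5) 1 M := IsManifold.of_le (n := ∞) (by simp)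
  have h := mfderiv_extChartAt_self (I := 𝓡 5) (x := x)
  exact congrArg (extDeriv (α.inChart x) (extChartAt (𝓡 5) x x))
    (funext fun i => DFunLike.congr_fun h (v i))

end

variable {G : Type*} [TopologicalSpace G] [ChartedSpace E5 G] [Group G] [LieGroup (𝓡 5) ∞ G]
  {k : ℕ}

theorem mdifferentiableAt_mul_left (g h : G) :
    MDifferentiableAt (𝓡 5) (𝓡 5) (fun x => g * x) h :=
  (contMDiff_mul_left (I := 𝓡 5) (n := ∞) (a := g)).contMDiffAt.mdifferentiableAt (by simp)

/-- The form with constant value, for the identification of all tangent spaces with `ℝ⁵`. -/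
def const (M : Type*) [TopologicalSpace M] [ChartedSpace E5 M] (a : E5 [⋀^Fin k]→L[ℝ] ℝ) :
    MForm M k :=
  fun _ => a

/-- The left-invariant form with a prescribed value at the identity. -/
def leftInvariant (G : Type*) [TopologicalSpace G] [ChartedSpace E5 G] [Group G]
    (a : E5 [⋀^Fin k]→L[ℝ] ℝ) : MForm G k :=
  fun g => (const G a).pullback (fun x => g⁻¹ * x) g

omit [LieGroup (𝓡 5) ∞ G] in
theorem leftInvariant_one (a : E5 [⋀^Fin k]→L[ℝ] ℝ) : leftInvariant G a 1 = a := by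
  have h : (fun x : G => (1 : G)⁻¹ * x) = id := by
    funext x
    simp
  unfold leftInvariant
  rw [h, pullback_id]
  rfl

theorem isLeftInvariant_leftInvariant (a : E5 [⋀^Fin k]→L[ℝ] ℝ) :
    (leftInvariant G a).IsLeftInvariant := by
  intro h
  funext g
  have e : (fun x : G => g⁻¹ * x) = (fun x => (h * g)⁻¹ * x) ∘ fun x => h * x := by
    funext x
    simp [mul_assoc]
  refine Eq.trans ?_ (congrArg (fun f => (const G a).pullback f g) e.symm)
  rw [pullback_comp _ _ _ (mdifferentiableAt_mul_left _ _) (mdifferentiableAt_mul_left _ _)]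
  exact pullback_congr_left _ rfl

omit [LieGroup (𝓡 5) ∞ G] in
-- Invariance under `g`, read at the identity: an invariant form is constant on invariant vector
-- fields.
theorem IsLeftInvariant.apply_mulInvariantVectorField {α : MForm G k} (hα : α.IsLeftInvariant)
    (g : G) (x : Fin k → GroupLieAlgebra (𝓡 5) G) :
    α g (fun i => mulInvariantVectorField (x i) g) = α 1 x := by
  have h := congrArg (fun β : MForm G k => β 1 x) (hα g)
  refine Eq.trans ?_ h
  exact apply_congr α (mul_one g).symm _

omit [LieGroup (𝓡 5) ∞ G] in
theorem IsLeftInvariant.ext {α β : MForm G k} (hα : α.IsLeftInvariant) (hβ : β.IsLeftInvariant)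
    (h : α 1 = β 1) : α = β := by
  funext g
  rw [← hα g⁻¹, ← hβ g⁻¹]
  ext v
  refine (apply_congr α (inv_mul_cancel g) _).trans
    (Eq.trans ?_ (apply_congr β (inv_mul_cancel g) _).symm)
  rw [h]

/-- Translation to the identity expresses the form at `z` as a fixed alternating form composed with
the derivative of `F z` at `z`. This derivative depends smoothly on `z` because multiplication and
inversion are smooth. -/
theorem IsLeftInvariant.isSmooth {α : MForm G k} (hα : α.IsLeftInvariant) : α.IsSmooth := by
  have : IsManifold (𝓡 5) ∞ G := LieGroup.toContMDiffMul.toIsManifold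
  intro x₀ y hy
  set c := (extChartAt (𝓡 5) x₀).symm with hc
  set e := extChartAt (𝓡 5) (1 : G) with he
  let F : E5 → E5 → E5 := fun y z => e ((c y)⁻¹ * c z)
  have h1 : ∀ z ∈ (extChartAt (𝓡 5) x₀).target,
      α.inChart x₀ z = (α.inChart 1 (e 1)).compContinuousLinearMap (fderiv ℝ (F z) z) := by
    intro z hz
    have hn : (c z)⁻¹ * c z ∈ (chartAt E5 (1 : G)).source := by
      rw [inv_mul_cancel]
      exact mem_chart_source _ _
    have h := (inChart_eventuallyEq (α := α) (β := α) isOpen_univ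
      (contMDiff_mul_left (I := 𝓡 5) (n := ∞) (a := (c z)⁻¹)).contMDiffOn
      (fun x _ => (congrFun (hα _) x).symm) hz (Set.mem_univ _) hn).self_of_nhds
    rw [h]
    simp only [Function.comp_apply, ← hc, inv_mul_cancel]
    rfl
  have hcs : ContMDiffAt 𝓘(ℝ, E5) (𝓡 5) ∞ c y :=
    (contMDiffOn_extChartAt_symm (n := ∞) x₀).contMDiffAt
      ((isOpen_extChartAt_target x₀).mem_nhds hy)
  have hF : ContDiffAt ℝ ∞ (Function.uncurry F) (y, y) := by
    rw [← contMDiffAt_iff_contDiffAt]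
    have hfst : ContMDiffAt 𝓘(ℝ, E5 × E5) (𝓡 5) ∞ (fun p : E5 × E5 => c p.1) (y, y) :=
      ContMDiffAt.comp (y, y) (g := c) hcs contDiff_fst.contDiffAt.contMDiffAt
    have hsnd : ContMDiffAt 𝓘(ℝ, E5 × E5) (𝓡 5) ∞ (fun p : E5 × E5 => c p.2) (y, y) :=
      ContMDiffAt.comp (y, y) (g := c) hcs contDiff_snd.contDiffAt.contMDiffAt
    refine ContMDiffAt.comp (y, y) (g := e) (f := fun p : E5 × E5 => (c p.1)⁻¹ * c p.2) ?_
      (hfst.inv.mul hsnd)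
    refine contMDiffAt_extChartAt' ?_
    rw [inv_mul_cancel]
    exact mem_chart_source _ _
  refine ContDiffAt.contDiffWithinAt (ContDiffAt.congr_of_eventuallyEq ?_
    (Filter.eventuallyEq_of_mem ((isOpen_extChartAt_target x₀).mem_nhds hy) h1))
  exact contDiffAt_const.alternating_compContinuousLinearMap
    (ContDiffAt.fderiv (g := id) hF contDiffAt_id (by simp))

theorem IsLeftInvariant.d {α : MForm G k} (hα : α.IsLeftInvariant) : α.d.IsLeftInvariant := by
  have : IsManifold (𝓡 5) ∞ G := LieGroup.toContMDiffMul.toIsManifold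
  intro g
  funext x
  exact (d_eq_of_eqOn_pullback hα.isSmooth isOpen_univ
    (contMDiff_mul_left (I := 𝓡 5) (n := ∞) (a := g)).contMDiffOn
    (fun x _ => (congrFun (hα g) x).symm) (Set.mem_univ x)).symm

omit [LieGroup (𝓡 5) ∞ G] in
theorem mulInvariantVectorField_one (v : GroupLieAlgebra (𝓡 5) G) :
    mulInvariantVectorField v (1 : G) = v := by
  have h : (fun x : G => 1 * x) = id := by
    funext x
    simp
  unfold mulInvariantVectorField
  rw [h, mfderiv_id]
  rfl

open VectorField in
/-- The Chevalley–Eilenberg formula for the exterior derivative of a left-invariant form. -/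
theorem IsLeftInvariant.d_one_apply {α : MForm G (k + 1)} (hα : α.IsLeftInvariant)
    (x : Fin (k + 2) → GroupLieAlgebra (𝓡 5) G) :
    α.d 1 x = - ∑ i : Fin (k + 1), ∑ j ≥ i, (-1) ^ (i + j : ℕ) •
      α 1 (Matrix.vecCons ⁅x i.castSucc, x j.succ⁆ (j.removeNth (i.castSucc.removeNth x))) := by
  have : IsManifold (𝓡 5) ∞ G := LieGroup.toContMDiffMul.toIsManifold
  have G1 : IsManifold (𝓡 5) 1 G := IsManifold.of_le (n := ∞) (by simp)
  have G2 : IsManifold (𝓡 5) 2 G := IsManifold.of_le (n := ∞) ENat.LEInfty.out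
  set c := extChartAt (𝓡 5) (1 : G) with hc
  -- The invariant vector fields read in the chart at the identity.
  let V : Fin (k + 2) → E5 → E5 := fun i =>
    mpullbackWithin 𝓘(ℝ, E5) (𝓡 5) c.symm (mulInvariantVectorField (x i)) (Set.range (𝓡 5))
  have hV1 : ∀ i, V i (c 1) = x i := by
    intro i
    have h2 := mfderivWithin_range_extChartAt_symm (I := 𝓡 5) (x := (1 : G))
    have h3 : ∀ p : G, p = 1 → (mulInvariantVectorField (x i) p : E5) = x i := by
      rintro p rfl
      exact mulInvariantVectorField_one _
    change (mfderivWithin 𝓘(ℝ, E5) (𝓡 5) c.symm (Set.range (𝓡 5)) (c 1)).inverse _ = _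
    rw [h2]
    refine Eq.trans ?_ (h3 _ (extChartAt_to_inv (I := 𝓡 5) (1 : G)))
    exact DFunLike.congr_fun (ContinuousLinearMap.inverse_id (R := ℝ) (M := E5)) _
  have hVd : ∀ i, DifferentiableAt ℝ (V i) (c 1) := by
    intro i
    have := (mdifferentiableAt_mulInvariantVectorField (x i) (g := (1 : G))).mdifferentiableWithinAt
      (s := Set.univ) |>.differentiableWithinAt_mpullbackWithin_vectorField
    rw [Set.preimage_univ, Set.univ_inter] at this
    refine DifferentiableWithinAt.differentiableAt this ?_
    rw [ModelWithCorners.range_eq_univ]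
    exact Filter.univ_mem
  have hbr : ∀ i j, lieBracket ℝ (V i) (V j) (c 1) = ⁅x i, x j⁆ := by
    intro i j
    have h1 : lieBracket ℝ (V i) (V j) (c 1) =
        lieBracketWithin ℝ (V i) (V j) (c.symm ⁻¹' Set.univ ∩ Set.range (𝓡 5)) (c 1) := by
      rw [Set.preimage_univ, Set.univ_inter, ModelWithCorners.range_eq_univ, lieBracketWithin_univ]
    have h2 : (mfderiv (𝓡 5) 𝓘(ℝ, E5) c (1 : G) : E5 →L[ℝ] E5) = ContinuousLinearMap.id ℝ E5 :=
      mfderiv_extChartAt_self (I := 𝓡 5) (x := (1 : G))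
    have h3 : ∀ A : E5 →L[ℝ] E5, A = ContinuousLinearMap.id ℝ E5 → ∀ v, v = A.inverse v := by
      rintro A rfl v
      rw [ContinuousLinearMap.inverse_id]
      rfl
    exact h1.trans (h3 _ h2 _)
  -- These functions are locally constant, so the directional derivatives drop out of the invariant
  -- formula for d and only the bracket terms remain.
  have hconst : ∀ i : Fin (k + 2), (fun y => α.inChart 1 y (i.removeNth (V · y))) =ᶠ[nhds (c 1)]
      fun _ => α 1 (i.removeNth x) := by
    intro i
    filter_upwards [(isOpen_extChartAt_target (I := 𝓡 5) (1 : G)).mem_nhds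
      (mem_extChartAt_target (I := 𝓡 5) (1 : G))] with y hy
    rw [← hα.apply_mulInvariantVectorField (c.symm y)]
    refine congrArg (α (c.symm y)) (funext fun j => ?_)
    have hi := isInvertible_mfderivWithin_extChartAt_symm (I := 𝓡 5) hy
    have := hi.self_apply_inverse (mulInvariantVectorField (i.removeNth x j) (c.symm y))
    refine Eq.trans ?_ this
    have h4 : (mfderivWithin 𝓘(ℝ, E5) (𝓡 5) c.symm (Set.range (𝓡 5)) y : E5 →L[ℝ] E5) =
        mfderiv 𝓘(ℝ, E5) (𝓡 5) c.symm y := by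
      rw [ModelWithCorners.range_eq_univ, mfderivWithin_univ]
    exact (DFunLike.congr_fun h4 _).symm
  have hd : DifferentiableAt ℝ (α.inChart 1) (c 1) :=
    (hα.isSmooth.contDiffAt (mem_extChartAt_target _)).differentiableAt (by simp)
  have key := extDeriv_apply_vectorField hd hVd
  have hx : (V · (c 1)) = x := funext hV1
  rw [hx] at key
  refine (d_apply α 1 x).trans (key.trans ?_)
  have h0 : ∀ (i : Fin (k + 2)) (w : E5),
      fderiv ℝ (fun y => α.inChart 1 y (i.removeNth (V · y))) (c 1) w = 0 := by
    intro i w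
    rw [(hconst i).fderiv_eq, fderiv_fun_const]
    rfl
  refine (congrArg₂ (· - ·) (Finset.sum_eq_zero fun i _ => ?_)
    (Finset.sum_congr rfl fun i _ => Finset.sum_congr rfl fun j _ => ?_)).trans (zero_sub _)
  · rw [h0, smul_zero]
  · rw [hbr]
    exact congrArg ((-1 : ℤ) ^ (i + j : ℕ) • ·) (inChart_self α 1 _)

end MForm

end

/-! ### Explicit evaluation of wedge products -/

noncomputable section

section

variable {V W : Type*} [AddCommGroup V] [Module ℝ V] [TopologicalSpace V]
  [AddCommGroup W] [Module ℝ W] [TopologicalSpace W] {k l : ℕ}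

theorem wedge_apply (α : V [⋀^Fin k]→L[ℝ] ℝ) (β : V [⋀^Fin l]→L[ℝ] ℝ) (v : Fin (k + l) → V) :
    wedge α β v = ((k ! : ℝ) * (l ! : ℝ))⁻¹ * ∑ σ : Equiv.Perm (Fin (k + l)),
      (Equiv.Perm.sign σ : ℤ) * (α (fun i => v (σ (Fin.castAdd l i))) *
        β (fun j => v (σ (Fin.natAdd k j)))) := by
  rw [wedge, ContinuousAlternatingMap.smul_apply, smul_eq_mul,
    ContinuousMultilinearMap.alternatization_apply_apply]
  congr 1
  refine Finset.sum_congr rfl fun σ _ => ?_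
  rw [Units.smul_def, zsmul_eq_mul]
  rfl

theorem wedge_compContinuousLinearMap (α : V [⋀^Fin k]→L[ℝ] ℝ) (β : V [⋀^Fin l]→L[ℝ] ℝ)
    (f : W →L[ℝ] V) : (wedge α β).compContinuousLinearMap f =
      wedge (α.compContinuousLinearMap f) (β.compContinuousLinearMap f) := by
  ext v
  rw [wedge_apply]
  exact wedge_apply α β _

theorem apply_fin_one (a : V [⋀^Fin 1]→L[ℝ] ℝ) (f : Fin 1 → V) : a f = a ![f 0] :=
  congrArg a (by ext i; fin_cases i; rfl)

theorem apply_fin_two (a : V [⋀^Fin 2]→L[ℝ] ℝ) (f : Fin 2 → V) : a f = a ![f 0, f 1] :=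
  congrArg a (by ext i; fin_cases i <;> rfl)

theorem apply_swap (a : V [⋀^Fin 2]→L[ℝ] ℝ) (x y : V) : a ![x, y] = - a ![y, x] := by
  refine Eq.trans (congrArg a ?_) (a.map_swap ![y, x] (i := 0) (j := 1) (by decide))
  ext i
  fin_cases i <;> rfl

/-- Iteration turns sums over the symmetric groups on 2, 3 and 4 letters into explicit lists. -/
theorem sum_perm_fin_succ {n : ℕ} (F : Equiv.Perm (Fin (n + 1)) → ℝ) :
    ∑ σ, F σ = ∑ p, ∑ e, F (Equiv.Perm.decomposeFin.symm (p, e)) := by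
  rw [Finset.univ_perm_fin_succ, Finset.sum_map, ← Finset.univ_product_univ, Finset.sum_product]
  rfl

theorem wedge_one_one_apply (a b : V [⋀^Fin 1]→L[ℝ] ℝ) (v : Fin 2 → V) :
    wedge a b v = a ![v 0] * b ![v 1] - a ![v 1] * b ![v 0] := by
  rw [wedge_apply]
  refine (congrArg _ (Finset.sum_congr rfl fun σ _ =>
    congrArg _ (congrArg₂ (· * ·) (apply_fin_one a _) (apply_fin_one b _)))).trans ?_
  change _ * ∑ σ : Equiv.Perm (Fin 2), (Equiv.Perm.sign σ : ℤ) *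
    (a ![v (σ 0)] * b ![v (σ (Fin.succ 0))]) = _
  simp only [sum_perm_fin_succ, Fin.sum_univ_two, Finset.univ_unique, Finset.sum_singleton,
    Equiv.Perm.decomposeFin.symm_sign, Equiv.Perm.decomposeFin_symm_apply_zero,
    Equiv.Perm.decomposeFin_symm_apply_succ]
  simp
  ring

theorem wedge_two_one_apply (a : V [⋀^Fin 2]→L[ℝ] ℝ) (b : V [⋀^Fin 1]→L[ℝ] ℝ) (v : Fin 3 → V) :
    wedge a b v = a ![v 0, v 1] * b ![v 2] - a ![v 0, v 2] * b ![v 1]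
      + a ![v 1, v 2] * b ![v 0] := by
  rw [wedge_apply]
  refine (congrArg _ (Finset.sum_congr rfl fun σ _ =>
    congrArg _ (congrArg₂ (· * ·) (apply_fin_two a _) (apply_fin_one b _)))).trans ?_
  change _ * ∑ σ : Equiv.Perm (Fin 3), (Equiv.Perm.sign σ : ℤ) *
    (a ![v (σ 0), v (σ (Fin.succ 0))] * b ![v (σ (Fin.succ (Fin.succ 0)))]) = _
  simp only [sum_perm_fin_succ, Fin.sum_univ_two, Fin.sum_univ_three, Finset.univ_unique, Finset.sum_singleton,
    Equiv.Perm.decomposeFin.symm_sign, Equiv.Perm.decomposeFin_symm_apply_zero,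
    Equiv.Perm.decomposeFin_symm_apply_succ]
  simp [Equiv.swap_apply_def]
  rw [apply_swap a (v 1) (v 0), apply_swap a (v 2) (v 0), apply_swap a (v 2) (v 1)]
  ring

theorem wedge_two_two_apply (a b : V [⋀^Fin 2]→L[ℝ] ℝ) (v : Fin 4 → V) :
    wedge a b v = a ![v 0, v 1] * b ![v 2, v 3] - a ![v 0, v 2] * b ![v 1, v 3]
      + a ![v 0, v 3] * b ![v 1, v 2] + a ![v 1, v 2] * b ![v 0, v 3]
      - a ![v 1, v 3] * b ![v 0, v 2] + a ![v 2, v 3] * b ![v 0, v 1] := by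
  rw [wedge_apply]
  refine (congrArg _ (Finset.sum_congr rfl fun σ _ =>
    congrArg _ (congrArg₂ (· * ·) (apply_fin_two a _) (apply_fin_two b _)))).trans ?_
  change _ * ∑ σ : Equiv.Perm (Fin 4), (Equiv.Perm.sign σ : ℤ) *
    (a ![v (σ 0), v (σ (Fin.succ 0))] *
      b ![v (σ (Fin.succ (Fin.succ 0))), v (σ (Fin.succ (Fin.succ (Fin.succ 0))))]) = _
  simp only [sum_perm_fin_succ, Fin.sum_univ_two, Fin.sum_univ_three, Fin.sum_univ_four,
    Finset.univ_unique, Finset.sum_singleton,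
    Equiv.Perm.decomposeFin.symm_sign, Equiv.Perm.decomposeFin_symm_apply_zero,
    Equiv.Perm.decomposeFin_symm_apply_succ]
  simp [Equiv.swap_apply_def]
  rw [apply_swap a (v 1) (v 0), apply_swap a (v 2) (v 0), apply_swap a (v 2) (v 1),
    apply_swap a (v 3) (v 0), apply_swap a (v 3) (v 1), apply_swap a (v 3) (v 2),
    apply_swap b (v 1) (v 0), apply_swap b (v 2) (v 0), apply_swap b (v 2) (v 1),
    apply_swap b (v 3) (v 0), apply_swap b (v 3) (v 1), apply_swap b (v 3) (v 2)]
  ring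

/-- Evaluation of `α ∧ β` for a one-form `β` that vanishes on all vectors but the last. -/
theorem wedge_one_right_apply (α : V [⋀^Fin k]→L[ℝ] ℝ) (β : V [⋀^Fin 1]→L[ℝ] ℝ)
    (v : Fin (k + 1) → V) (h : ∀ i : Fin k, β ![v i.castSucc] = 0) :
    wedge α β v = α (fun i => v i.castSucc) * β ![v (Fin.last k)] := by
  -- The image of `T` is the stabilizer of the last index. Outside it β receives a vector that it
  -- kills; inside it the sign of the permutation cancels the sign from reordering the arguments of
  -- α, leaving k! equal terms.
  let T : Equiv.Perm (Fin k) → Equiv.Perm (Fin (k + 1)) := fun e =>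
    finSumFinEquiv.permCongr (Equiv.Perm.sumCongr e 1)
  have hTc : ∀ e i, T e (Fin.castAdd 1 i) = Fin.castAdd 1 (e i) := by
    intro e i
    simp [T, Equiv.permCongr_apply]
  have hTl : ∀ e, T e (Fin.natAdd k 0) = Fin.last k := by
    intro e
    simp [T, Equiv.permCongr_apply]
    rfl
  have hsum : ∑ σ : Equiv.Perm (Fin (k + 1)),
      ((Equiv.Perm.sign σ : ℤ) : ℝ) * (α (fun i => v (σ (Fin.castAdd 1 i))) *
        β (fun j => v (σ (Fin.natAdd k j)))) =
      ∑ e : Equiv.Perm (Fin k), α (fun i => v i.castSucc) * β ![v (Fin.last k)] := by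
    symm
    refine Finset.sum_of_injOn T ?_ (fun _ _ => Finset.mem_univ _) ?_ ?_
    · intro e _ e' _ hee
      ext i
      have := congrArg (fun p : Equiv.Perm (Fin (k + 1)) => (p (Fin.castAdd 1 i)).val) hee
      simpa only [hTc, Fin.val_castAdd] using this
    · intro σ _ hσ
      rw [apply_fin_one β]
      have hne : σ (Fin.natAdd k 0) ≠ Fin.last k := by
        intro hl
        refine hσ ?_
        obtain ⟨⟨e, e'⟩, he⟩ := Equiv.Perm.mem_sumCongrHom_range_of_perm_mapsTo_inl
          (σ := (finSumFinEquiv (m := k) (n := 1)).symm.permCongr σ) (by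
            rintro _ ⟨i, rfl⟩
            have hi : σ (Fin.castAdd 1 i) ≠ Fin.last k := by
              rw [← hl]
              intro hi
              have := congrArg Fin.val (σ.injective hi)
              simp at this
              omega
            obtain ⟨j, hj⟩ := Fin.exists_castSucc_eq.2 hi
            refine ⟨j, ?_⟩
            rw [Equiv.permCongr_apply, Equiv.symm_symm, finSumFinEquiv_apply_left, ← hj,
              Equiv.eq_symm_apply, finSumFinEquiv_apply_left]
            rfl)
        refine ⟨e, Finset.mem_coe.2 (Finset.mem_univ _), ?_⟩
        have he' : e' = 1 := Subsingleton.elim _ _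
        subst he'
        change finSumFinEquiv.permCongr _ = σ
        rw [Equiv.Perm.sumCongrHom_apply] at he
        rw [he]
        exact (finSumFinEquiv (m := k) (n := 1)).permCongr.apply_symm_apply σ
      obtain ⟨i, hi⟩ := Fin.exists_castSucc_eq.2 hne
      rw [← hi, h i, mul_zero, mul_zero]
    · intro e _
      have h1 : (fun i => v (T e (Fin.castAdd 1 i))) = (fun i => v i.castSucc) ∘ e := by
        funext i
        rw [hTc]
        rfl
      rw [apply_fin_one β fun j => v (T e (Fin.natAdd k j)), hTl, h1]
      have h2 : α ((fun i => v i.castSucc) ∘ e) = Equiv.Perm.sign e • α fun i => v i.castSucc :=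
        α.toAlternatingMap.map_perm _ _
      have h3 : Equiv.Perm.sign (T e) = Equiv.Perm.sign e := by
        simp [T, Equiv.Perm.sign_permCongr, Equiv.Perm.sign_sumCongr]
      rw [h2, h3, Units.smul_def, zsmul_eq_mul]
      have h4 : ((Equiv.Perm.sign e : ℤ) : ℝ) * ((Equiv.Perm.sign e : ℤ) : ℝ) = 1 := by
        rw [← Int.cast_mul, ← Units.val_mul, Int.units_mul_self]
        simp
      linear_combination (-(α fun i => v i.castSucc) * β ![v (Fin.last k)]) * h4
  rw [wedge_apply, hsum, Finset.sum_const, Finset.card_univ, Fintype.card_perm, Fintype.card_fin,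
    nsmul_eq_mul]
  have : (k ! : ℝ) ≠ 0 := by positivity
  simp
  field_simp

end

end

/-! ### Descent to the nilmanifold and the pointwise SU(2) conditions -/

noncomputable section

namespace MForm

section

variable {M N : Type*} [TopologicalSpace M] [ChartedSpace E5 M]
  [TopologicalSpace N] [ChartedSpace E5 N] {k l : ℕ}

theorem pullback_wedge (f : M → N) (α : MForm N k) (β : MForm N l) :
    (α.wedge β).pullback f = (α.pullback f).wedge (β.pullback f) :=
  funext fun _ => wedge_compContinuousLinearMap _ _ _

theorem pullback_stdOmega (f : M → N) (e : Fin 5 → MForm N 1) (i : Fin 3) :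
    (stdOmega e i).pullback f = stdOmega (fun j => (e j).pullback f) i := by
  fin_cases i
  · exact congrArg₂ (· + ·) (pullback_wedge f (e 1) (e 3)) (pullback_wedge f (e 4) (e 2))
  · exact congrArg₂ (· + ·) (pullback_wedge f (e 1) (e 4)) (pullback_wedge f (e 2) (e 3))
  · exact congrArg₂ (· + ·) (pullback_wedge f (e 1) (e 2)) (pullback_wedge f (e 3) (e 4))

end

variable {G : Type*} [TopologicalSpace G] [ChartedSpace E5 G] [Group G] {k l : ℕ}

theorem IsLeftInvariant.wedge {α : MForm G k} {β : MForm G l} (hα : α.IsLeftInvariant)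
    (hβ : β.IsLeftInvariant) : (α.wedge β).IsLeftInvariant := fun g => by
  rw [pullback_wedge, hα g, hβ g]

theorem isLeftInvariant_stdOmega {e : Fin 5 → MForm G 1} (h : ∀ i, (e i).IsLeftInvariant)
    (i : Fin 3) : (stdOmega e i).IsLeftInvariant := fun g => by
  rw [pullback_stdOmega]
  exact congrArg (fun e' => stdOmega e' i) (funext fun j => h j g)

end MForm

namespace IsCompactNilmanifold

variable {G : Type*} [TopologicalSpace G] [ChartedSpace E5 G] [Group G] [LieGroup (𝓡 5) ∞ G]
  {N : Type*} [TopologicalSpace N] [ChartedSpace E5 N] [IsManifold (𝓡 5) ∞ N]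
  {Γ : Subgroup G} {π : G → N} {k : ℕ}

omit [IsManifold (𝓡 5) ∞ N] in
theorem mdifferentiableAt (hN : IsCompactNilmanifold Γ π) (g : G) :
    MDifferentiableAt (𝓡 5) (𝓡 5) π g :=
  (hN.isLocalDiffeomorph g).mdifferentiableAt (by simp)

/-- The differential of the projection, as a linear equivalence. -/
def dEquiv (hN : IsCompactNilmanifold Γ π) (g : G) :
    TangentSpace (𝓡 5) g ≃L[ℝ] TangentSpace (𝓡 5) (π g) :=
  (hN.isLocalDiffeomorph g).mfderivToContinuousLinearEquiv (by simp)

omit [IsManifold (𝓡 5) ∞ N] in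
-- The projection is surjective with invertible differential.
theorem pullback_injective (hN : IsCompactNilmanifold Γ π) {α β : MForm N k}
    (h : α.pullback π = β.pullback π) : α = β := by
  funext x
  obtain ⟨g, rfl⟩ := hN.surjective x
  ext v
  have := congrArg (fun γ : MForm G k => γ g (fun i => (hN.dEquiv g).symm (v i))) h
  have hv : (fun i => mfderiv (𝓡 5) (𝓡 5) π g ((hN.dEquiv g).symm (v i))) = v :=
    funext fun i => (hN.dEquiv g).apply_symm_apply (v i)
  simp only [MForm.pullback_apply] at this
  rwa [hv] at this

omit [IsManifold (𝓡 5) ∞ N] in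
/-- Left-invariant forms descend to the quotient. -/
theorem exists_pullback_eq (hN : IsCompactNilmanifold Γ π) {α : MForm G k}
    (hα : α.IsLeftInvariant) : ∃ β : MForm N k, β.pullback π = α := by
  -- An arbitrary set-theoretic section suffices: two points of a fibre differ by some γ in Γ, π is
  -- unchanged by translation by γ, and α is invariant under it. Smoothness is obtained separately.
  choose s hs using hN.surjective
  let D : ∀ g : G, E5 ≃L[ℝ] E5 := fun g => hN.dEquiv g
  let β : MForm N k := fun x =>
    (α (s x) : E5 [⋀^Fin k]→L[ℝ] ℝ).compContinuousLinearMap ((D (s x)).symm : E5 →L[ℝ] E5)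
  refine ⟨β, funext fun g => ?_⟩
  obtain ⟨γ, hγ, hg⟩ := (hN.fibre g (s (π g))).1 (hs (π g)).symm
  have hπ : π ∘ (fun h => γ * h) = π :=
    funext fun h => ((hN.fibre h (γ * h)).2 ⟨γ, hγ, rfl⟩).symm
  have hD : ∀ v : E5, D g v = D (γ * g) (mfderiv (𝓡 5) (𝓡 5) (fun h => γ * h) g v) := by
    intro v
    have h1 := mfderiv_comp g (hN.mdifferentiableAt (γ * g)) (MForm.mdifferentiableAt_mul_left γ g)
    have h2 : (mfderiv (𝓡 5) (𝓡 5) (π ∘ fun h => γ * h) g : E5 →L[ℝ] E5) =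
      mfderiv (𝓡 5) (𝓡 5) π g := by rw [hπ]
    exact (DFunLike.congr_fun h2 v).symm.trans (DFunLike.congr_fun h1 v)
  ext v
  rw [← hα γ]
  change (α (s (π g)) : E5 [⋀^Fin k]→L[ℝ] ℝ) (fun i => (D (s (π g))).symm (D g (v i))) =
    (α (γ * g) : E5 [⋀^Fin k]→L[ℝ] ℝ)
      (fun i => (mfderiv (𝓡 5) (𝓡 5) (fun h => γ * h) g : E5 →L[ℝ] E5) (v i))
  rw [hg]
  refine congrArg _ (funext fun i => ?_)
  exact (congrArg (D (γ * g)).symm (hD (v i))).trans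
    (ContinuousLinearEquiv.symm_apply_apply (D (γ * g)) _)

/-- Along local inverses of π the form is a pullback of its lift, which is left-invariant and hence
smooth. -/
theorem isSmooth (hN : IsCompactNilmanifold Γ π) {α : MForm N k} (hα : α.IsInvariant π) :
    α.IsSmooth := by
  have : IsManifold (𝓡 5) ∞ G := LieGroup.toContMDiffMul.toIsManifold
  refine hα.isSmooth.of_locally_pullback fun x => ?_
  obtain ⟨g, rfl⟩ := hN.surjective x
  have hg := hN.isLocalDiffeomorph g
  refine ⟨hg.localInverse.source, hg.localInverse_open_source, hg.localInverse_mem_source,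
    hg.localInverse, hg.contmdiffOn_localInverse, fun y hy => ?_⟩
  have hσ : MDifferentiableAt (𝓡 5) (𝓡 5) hg.localInverse y :=
    (hg.contmdiffOn_localInverse.contMDiffAt
      (hg.localInverse_open_source.mem_nhds hy)).mdifferentiableAt (by simp)
  rw [← MForm.pullback_comp _ _ _ (hN.mdifferentiableAt _) hσ,
    MForm.pullback_congr_of_eventuallyEq (g := id), MForm.pullback_id]
  exact Filter.eventuallyEq_of_mem (hg.localInverse_open_source.mem_nhds hy)
    hg.localInverse_eqOn_right

theorem d_eq_zero (hN : IsCompactNilmanifold Γ π) {α : MForm N k} (hα : α.IsInvariant π)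
    (h : (α.pullback π).d 1 = 0) : α.d = 0 := by
  have : IsManifold (𝓡 5) ∞ G := LieGroup.toContMDiffMul.toIsManifold
  have h0 : (0 : MForm G (k + 1)).IsLeftInvariant := fun g => rfl
  have h1 : (α.pullback π).d = 0 := MForm.IsLeftInvariant.ext hα.d h0 h
  refine hN.pullback_injective ?_
  refine Eq.trans ?_ h1
  funext g
  exact (MForm.d_eq_of_eqOn_pullback (hN.isSmooth hα) isOpen_univ
    hN.isLocalDiffeomorph.contMDiff.contMDiffOn (fun _ _ => rfl) (Set.mem_univ g)).symm

end IsCompactNilmanifold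

section

variable {V : Type*} [AddCommGroup V] [Module ℝ V] [TopologicalSpace V]

/-- The standard triple of two-forms on a vector space. -/
def stdTriple (a : Fin 5 → V [⋀^Fin 1]→L[ℝ] ℝ) : Fin 3 → V [⋀^Fin 2]→L[ℝ] ℝ :=
  ![wedge (a 1) (a 3) + wedge (a 4) (a 2), wedge (a 1) (a 4) + wedge (a 2) (a 3),
    wedge (a 1) (a 2) + wedge (a 3) (a 4)]

theorem stdTriple_zero_apply (a : Fin 5 → V [⋀^Fin 1]→L[ℝ] ℝ) (x y : V) :
    stdTriple a 0 ![x, y] = a 1 ![x] * a 3 ![y] - a 1 ![y] * a 3 ![x]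
      + (a 4 ![x] * a 2 ![y] - a 4 ![y] * a 2 ![x]) :=
  congrArg₂ (· + ·) (wedge_one_one_apply _ _ _) (wedge_one_one_apply _ _ _)

theorem stdTriple_one_apply (a : Fin 5 → V [⋀^Fin 1]→L[ℝ] ℝ) (x y : V) :
    stdTriple a 1 ![x, y] = a 1 ![x] * a 4 ![y] - a 1 ![y] * a 4 ![x]
      + (a 2 ![x] * a 3 ![y] - a 2 ![y] * a 3 ![x]) :=
  congrArg₂ (· + ·) (wedge_one_one_apply _ _ _) (wedge_one_one_apply _ _ _)

theorem stdTriple_two_apply (a : Fin 5 → V [⋀^Fin 1]→L[ℝ] ℝ) (x y : V) :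
    stdTriple a 2 ![x, y] = a 1 ![x] * a 2 ![y] - a 1 ![y] * a 2 ![x]
      + (a 3 ![x] * a 4 ![y] - a 3 ![y] * a 4 ![x]) :=
  congrArg₂ (· + ·) (wedge_one_one_apply _ _ _) (wedge_one_one_apply _ _ _)

/-- Each square is 2a¹²³⁴, and every mixed product repeats a factor. The identities are formal and
need no independence of the one-forms. -/
theorem wedge_stdTriple (a : Fin 5 → V [⋀^Fin 1]→L[ℝ] ℝ) (i j : Fin 3) :
    wedge (stdTriple a i) (stdTriple a j) =
      if i = j then wedge (stdTriple a 0) (stdTriple a 0) else 0 := by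
  ext v
  by_cases h : i = j
  · subst h
    rw [if_pos rfl, wedge_two_two_apply, wedge_two_two_apply]
    fin_cases i
    · rfl
    · simp only [Fin.mk_one, stdTriple_one_apply, stdTriple_zero_apply]
      ring
    · simp only [Fin.reduceFinMk, stdTriple_two_apply, stdTriple_zero_apply]
      ring
  · rw [if_neg h, wedge_two_two_apply]
    change _ = (0 : ℝ)
    fin_cases i <;> fin_cases j <;> first
    | exact absurd rfl h
    | simp only [Fin.mk_one, Fin.zero_eta, Fin.reduceFinMk, stdTriple_one_apply,
        stdTriple_zero_apply, stdTriple_two_apply]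
      ring

/-- Avoids the expansion over 120 permutations when checking that the volume form is nonzero. -/
theorem wedge_four_one_apply (A : V [⋀^Fin (2 + 2)]→L[ℝ] ℝ) (b : V [⋀^Fin 1]→L[ℝ] ℝ)
    {x y z w t : V} (hx : b ![x] = 0) (hy : b ![y] = 0) (hz : b ![z] = 0) (hw : b ![w] = 0) :
    wedge A b ![x, y, z, w, t] = A ![x, y, z, w] * b ![t] := by
  have h := wedge_one_right_apply A b ![x, y, z, w, t] (by
    intro i
    fin_cases i
    · exact hx
    · exact hy
    · exact hz
    · exact hw)
  refine h.trans ?_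
  congr 2
  ext i
  fin_cases i <;> rfl

theorem wedge_stdTriple_apply {a : Fin 5 → V [⋀^Fin 1]→L[ℝ] ℝ} {X : Fin 5 → V}
    (hX : ∀ i j, a i ![X j] = if i = j then 1 else 0) :
    wedge (stdTriple a 0) (stdTriple a 0) ![X 1, X 2, X 3, X 4] = 2 := by
  have h := wedge_two_two_apply (stdTriple a 0) (stdTriple a 0) ![X 1, X 2, X 3, X 4]
  refine h.trans ?_
  change stdTriple a 0 ![X 1, X 2] * stdTriple a 0 ![X 3, X 4]
    - stdTriple a 0 ![X 1, X 3] * stdTriple a 0 ![X 2, X 4]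
    + stdTriple a 0 ![X 1, X 4] * stdTriple a 0 ![X 2, X 3]
    + stdTriple a 0 ![X 2, X 3] * stdTriple a 0 ![X 1, X 4]
    - stdTriple a 0 ![X 2, X 4] * stdTriple a 0 ![X 1, X 3]
    + stdTriple a 0 ![X 3, X 4] * stdTriple a 0 ![X 1, X 2] = 2
  simp only [stdTriple_zero_apply, hX]
  simp
  norm_num

theorem wedge_stdTriple_wedge_ne_zero {a : Fin 5 → V [⋀^Fin 1]→L[ℝ] ℝ} {X : Fin 5 → V}
    (hX : ∀ i j, a i ![X j] = if i = j then 1 else 0) :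
    wedge (wedge (stdTriple a 0) (stdTriple a 0)) (a 0) ≠ 0 := by
  intro h
  have h1 := wedge_four_one_apply (wedge (stdTriple a 0) (stdTriple a 0)) (a 0) (t := X 0)
    (hX 0 1) (hX 0 2) (hX 0 3) (hX 0 4)
  rw [wedge_stdTriple_apply hX, h, hX 0 0] at h1
  norm_num at h1

/-- Testing the hypothesis on X₁, …, X₄ gives (y₁, y₂, y₃, y₄) = (-x₄, -x₃, x₂, x₁), so the value is
x₁² + x₂² + x₃² + x₄². -/
theorem stdTriple_one_nonneg {a : Fin 5 → V [⋀^Fin 1]→L[ℝ] ℝ} {X : Fin 5 → V}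
    (hX : ∀ i j, a i ![X j] = if i = j then 1 else 0) {x y : V}
    (h : ∀ z, stdTriple a 2 ![x, z] = stdTriple a 0 ![y, z]) : 0 ≤ stdTriple a 1 ![x, y] := by
  have h1 := h (X 1)
  have h2 := h (X 2)
  have h3 := h (X 3)
  have h4 := h (X 4)
  rw [stdTriple_one_apply]
  simp [stdTriple_zero_apply, stdTriple_two_apply, hX] at h1 h2 h3 h4
  rw [← h1, ← h2, ← h3, show a 2 ![y] = -a 3 ![x] by linarith]
  nlinarith [sq_nonneg (a 1 ![x]), sq_nonneg (a 2 ![x]), sq_nonneg (a 3 ![x]), sq_nonneg (a 4 ![x])]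

end

theorem isSU2Structure_std {M : Type*} [TopologicalSpace M] [ChartedSpace E5 M]
    {e : Fin 5 → MForm M 1} (h0 : (stdEta e).IsSmooth) (hs : ∀ i, (stdOmega e i).IsSmooth)
    (hX : ∀ x : M, ∃ X : Fin 5 → TangentSpace (𝓡 5) x,
      ∀ i j, e i x ![X j] = if i = j then 1 else 0) :
    IsSU2Structure (stdEta e) (stdOmega e) := by
  have ho : ∀ i x, stdOmega e i x = stdTriple (fun j => e j x) i := by
    intro i x
    fin_cases i <;> rfl
  refine ⟨h0, hs, ⟨(stdOmega e 0).wedge (stdOmega e 0), fun i j => ?_, fun x => ?_⟩,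
    fun x a b h => ?_⟩
  · funext x
    refine Eq.trans ?_ ((wedge_stdTriple (fun k => e k x) i j).trans ?_)
    · rw [← ho, ← ho]
      rfl
    · by_cases h : i = j
      · rw [if_pos h, if_pos h]
        rfl
      · rw [if_neg h, if_neg h]
        rfl
  · obtain ⟨X, hX⟩ := hX x
    have := wedge_stdTriple_wedge_ne_zero (a := fun j => e j x) hX
    rw [← ho] at this
    exact this
  · obtain ⟨X, hX⟩ := hX x
    rw [ho]
    refine stdTriple_one_nonneg hX fun z => ?_
    rw [← ho, ← ho]
    exact h z

end

/-! ### Structure of five-dimensional nilpotent Lie algebras -/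

noncomputable section

section NilpotentLieAlgebra

variable {L : Type*} [LieRing L] [LieAlgebra ℝ L] [LieRing.IsNilpotent L]

/-- The operator ad x is nilpotent, so 0 is its only eigenvalue. -/
theorem eq_zero_of_lie_eq_smul {x y : L} {b : ℝ} (h : ⁅x, y⁆ = b • y) : ⁅x, y⁆ = 0 := by
  obtain ⟨n, hn⟩ := LieModule.isNilpotent_toEnd_of_isNilpotent ℝ L L x
  have h1 : ∀ m : ℕ, (LieModule.toEnd ℝ L L x ^ m) y = b ^ m • y := by
    intro m
    induction m with
    | zero => simp
    | succ m ih =>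
      rw [pow_succ', Module.End.mul_apply, ih, map_smul, LieModule.toEnd_apply_apply, h, smul_smul,
        pow_succ]
  have h2 : b ^ n • y = 0 := by rw [← h1, hn, LinearMap.zero_apply]
  rcases smul_eq_zero.1 h2 with h3 | h3
  · rw [h, eq_zero_of_pow_eq_zero h3, zero_smul]
  · rw [h3, lie_zero]

/-- Unimodularity, used for the closedness of ω₃ ∧ ω₃. -/
theorem trace_ad_eq_zero (x : L) : LinearMap.trace ℝ L (LieAlgebra.ad ℝ L x) = 0 :=
  (LinearMap.isNilpotent_trace_of_isNilpotent
    (LieModule.isNilpotent_toEnd_of_isNilpotent ℝ L L x)).eq_zero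

theorem exists_central_ne_zero [Nontrivial L] : ∃ z : L, z ≠ 0 ∧ ∀ x : L, ⁅x, z⁆ = 0 := by
  have := LieModule.nontrivial_max_triv_of_isNilpotent ℝ L L
  obtain ⟨⟨z, hz⟩, hne⟩ := exists_ne (0 : LieModule.maxTrivSubmodule ℝ L L)
  exact ⟨z, fun h => hne (Subtype.ext h), hz⟩

/-- A one-dimensional central subspace is properly contained in its normalizer. -/
theorem exists_lie_mem_span {z : L} (hz : ∀ x : L, ⁅x, z⁆ = 0)
    (hdim : Submodule.span ℝ {z} ≠ ⊤) :
    ∃ y : L, y ∉ Submodule.span ℝ {z} ∧ ∀ x : L, ⁅x, y⁆ ∈ Submodule.span ℝ {z} := by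
  -- The quotient by the central line is nilpotent and nonzero, so it has a nonzero central class;
  -- `y` is a lift of it.
  let I : LieSubmodule ℝ L L :=
    { Submodule.span ℝ {z} with
      lie_mem := by
        intro x m hm
        obtain ⟨a, rfl⟩ := Submodule.mem_span_singleton.1 hm
        rw [lie_smul, hz, smul_zero]
        exact Submodule.zero_mem _ }
  have hI : ∀ y, y ∈ I ↔ y ∈ Submodule.span ℝ {z} := fun y => Iff.rfl
  have hnil : LieModule.IsNilpotent L (L ⧸ I) := by
    rw [LieModule.isNilpotent_quotient_iff (R := ℝ)]
    obtain ⟨k, hk⟩ := LieModule.IsNilpotent.nilpotent ℝ L L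
    exact ⟨k, hk ▸ bot_le⟩
  have hnt : Nontrivial (L ⧸ I) := Submodule.Quotient.nontrivial_iff.2 hdim
  have := LieModule.nontrivial_max_triv_of_isNilpotent ℝ L (L ⧸ I)
  obtain ⟨⟨q, hq⟩, hne⟩ := exists_ne (0 : LieModule.maxTrivSubmodule ℝ L (L ⧸ I))
  obtain ⟨y, rfl⟩ := LieSubmodule.Quotient.surjective_mk' I q
  refine ⟨y, fun hy => hne (Subtype.ext ((LieSubmodule.Quotient.mk_eq_zero I).2 hy)), fun x => ?_⟩
  have h := hq x
  rw [← LieModuleHom.map_lie] at h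
  exact (LieSubmodule.Quotient.mk_eq_zero I).1 h

/-- The derived algebra and a proper central subspace do not span a nilpotent Lie algebra. -/
theorem derived_sup_ne_top {W : Submodule ℝ L} (hW : ∀ x : L, ∀ w ∈ W, ⁅x, w⁆ = 0)
    (hne : W ≠ ⊤) : (LieModule.lowerCentralSeries ℝ L L 1).toSubmodule ⊔ W ≠ ⊤ := by
  intro htop
  -- If L = [L, L] + W with W central, then [L, L] = [L, [L, L]]. The lower central series is then
  -- constant from index 1 on, so [L, L] = 0 and W is everything.
  have hstep : ∀ k, LieModule.lowerCentralSeries ℝ L L 1 ≤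
      LieModule.lowerCentralSeries ℝ L L (k + 1) := by
    intro k
    induction k with
    | zero => exact le_rfl
    | succ k ih =>
      rw [LieModule.lowerCentralSeries_succ ℝ L L 0, LieSubmodule.lieIdeal_oper_eq_span,
        LieSubmodule.lieSpan_le]
      rintro _ ⟨x, y, rfl⟩
      have hy : (y : L) ∈ (LieModule.lowerCentralSeries ℝ L L 1).toSubmodule ⊔ W :=
        htop ▸ Submodule.mem_top
      obtain ⟨d, hd, w, hw, hdw⟩ := Submodule.mem_sup.1 hy
      rw [← hdw, lie_add]
      have hxw : ⁅(x : L), w⁆ = 0 := hW _ w hw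
      rw [hxw, add_zero, LieModule.lowerCentralSeries_succ ℝ L L (k + 1)]
      exact LieSubmodule.lie_mem_lie x.2 (ih hd)
  obtain ⟨k, hk⟩ := LieModule.IsNilpotent.nilpotent ℝ L L
  have h1 : LieModule.lowerCentralSeries ℝ L L 1 = ⊥ :=
    le_bot_iff.1 ((hstep k).trans (hk ▸ LieModule.antitone_lowerCentralSeries ℝ L L k.le_succ))
  rw [h1, LieSubmodule.bot_toSubmodule, bot_sup_eq] at htop
  exact hne htop

/-- In a nilpotent Lie algebra of dimension at least three there are an ideal of codimension one
containing the derived algebra and two independent vectors of its centre. -/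
theorem exists_functional (h3 : 3 ≤ Module.finrank ℝ L) :
    ∃ (f : L →ₗ[ℝ] ℝ) (z : Fin 2 → L), f ≠ 0 ∧ LinearIndependent ℝ z ∧
      (∀ x y : L, f ⁅x, y⁆ = 0) ∧ (∀ i, f (z i) = 0) ∧ ∀ (x : L) i, f x = 0 → ⁅x, z i⁆ = 0 := by
  have hfin : FiniteDimensional ℝ L := Module.finite_of_finrank_pos (by omega)
  have : Nontrivial L := Module.nontrivial_of_finrank_pos (R := ℝ) (by omega)
  obtain ⟨z, hz0, hz⟩ := exists_central_ne_zero (L := L)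
  have hspan : ∀ s : Finset L, s.card ≤ 2 → Submodule.span ℝ (s : Set L) ≠ ⊤ := by
    intro s hs h
    have := finrank_span_finset_le_card (R := ℝ) s
    rw [Set.finrank, h, finrank_top] at this
    omega
  obtain ⟨y, hy, hyz⟩ := exists_lie_mem_span hz (by simpa using hspan {z} (by simp))
  have hli : LinearIndependent ℝ ![y, z] := by
    rw [LinearIndependent.pair_symm_iff, LinearIndependent.pair_iff' hz0]
    exact fun a ha => hy (Submodule.mem_span_singleton.2 ⟨a, ha⟩)
  obtain ⟨g, hg⟩ : ∃ g : Module.Dual ℝ L, g z = 1 := by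
    by_contra! h
    refine hz0 ((Module.forall_dual_apply_eq_zero_iff ℝ z).1 fun g => ?_)
    by_contra hg
    exact h ((g z)⁻¹ • g) (by simp [hg])
  let p : L →ₗ[ℝ] ℝ := -(g ∘ₗ LieModule.toEnd ℝ L L y)
  have hp : ∀ x, p x = g ⁅x, y⁆ := fun x => by
    rw [← lie_skew, map_neg]
    rfl
  have hpz : ∀ x, ⁅x, y⁆ = p x • z := by
    intro x
    obtain ⟨a, ha⟩ := Submodule.mem_span_singleton.1 (hyz x)
    rw [hp, ← ha, map_smul, hg, smul_eq_mul, mul_one]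
  -- Here [x, y] = p(x) z. If p = 0, then y and z are both central, and the derived algebra together
  -- with their span lies in a hyperplane, the kernel of the required functional. Otherwise p itself
  -- serves: its kernel is the centralizer of y, and it contains all brackets by the Jacobi
  -- identity, since z is central.
  by_cases h0 : p = 0
  · have hW : ∀ x : L, ∀ w ∈ Submodule.span ℝ {y, z}, ⁅x, w⁆ = 0 := by
      intro x w hw
      obtain ⟨a, b, rfl⟩ := Submodule.mem_span_pair.1 hw
      rw [lie_add, lie_smul, lie_smul, hz, hpz, h0]
      simp
    have hne := derived_sup_ne_top hW (by
      classical simpa using hspan {y, z} (Finset.card_insert_le _ _))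
    obtain ⟨f, hf0, hf⟩ := Submodule.exists_le_ker_of_lt_top _ (lt_top_iff_ne_top.2 hne)
    refine ⟨f, ![y, z], hf0, hli, fun x x' => hf (Submodule.mem_sup_left ?_), fun i =>
      hf (Submodule.mem_sup_right ?_), fun x i _ => hW x _ ?_⟩
    · rw [LieModule.lowerCentralSeries_succ]
      exact LieSubmodule.lie_mem_lie (LieSubmodule.mem_top x) (LieSubmodule.mem_top x')
    all_goals
      refine Submodule.subset_span ?_
      fin_cases i <;> simp
  · have hz' : ∀ x : L, ⁅z, x⁆ = 0 := fun x => by rw [← lie_skew, hz, neg_zero]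
    refine ⟨p, ![y, z], h0, hli, fun x x' => ?_, fun i => ?_, fun x i hx => ?_⟩
    · rw [hp, lie_lie, hpz x', hpz x, lie_smul, lie_smul, hz, hz]
      simp
    · fin_cases i
      · change p y = 0
        rw [hp, lie_self, map_zero]
      · change p z = 0
        rw [hp, hz', map_zero]
    · fin_cases i
      · change ⁅x, y⁆ = 0
        rw [hpz, hx, zero_smul]
      · exact hz x


/-- Every five-dimensional nilpotent Lie algebra has a basis `X₀, …, X₄` such that
`X₁, …, X₄` span an ideal containing the derived algebra, whose only nonzero bracket is
`[X₁, X₂] = c X₄`. -/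
theorem exists_adapted_basis (h5 : Module.finrank ℝ L = 5) :
    ∃ (X : Module.Basis (Fin 5) ℝ L) (c : ℝ), (∀ x y : L, X.coord 0 ⁅x, y⁆ = 0) ∧
      ∀ x y : L, ⁅x, y⁆ = X.coord 0 x • ⁅X 0, y⁆ - X.coord 0 y • ⁅X 0, x⁆ +
        (c * (X.coord 1 x * X.coord 2 y - X.coord 1 y * X.coord 2 x)) • X 4 := by
  have hfin : FiniteDimensional ℝ L := Module.finite_of_finrank_pos (by omega)
  obtain ⟨f, z, hf, hz, hfl, hfz, hcz⟩ := exists_functional (L := L) (by omega)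
  obtain ⟨T, hT⟩ : ∃ T, f T = 1 := by
    obtain ⟨v, hv⟩ := LinearMap.surjective hf 1
    exact ⟨v, hv⟩
  have hker : Module.finrank ℝ (LinearMap.ker f) = 4 := by
    have h1 := LinearMap.finrank_range_add_finrank_ker f
    rw [LinearMap.range_eq_top.2 (LinearMap.surjective hf), finrank_top, Module.finrank_self] at h1
    omega
  have hex : ∀ (n : ℕ) (v : Fin n → L), n < 4 → LinearIndependent ℝ v →
      ∃ x, f x = 0 ∧ LinearIndependent ℝ (Matrix.vecCons x v) := by
    intro n v hn hv
    have h1 : ¬ LinearMap.ker f ≤ Submodule.span ℝ (Set.range v) := by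
      intro h
      have h2 := Submodule.finrank_mono h
      rw [hker, finrank_span_eq_card hv, Fintype.card_fin] at h2
      omega
    obtain ⟨x, hx, hxv⟩ := SetLike.not_le_iff_exists.1 h1
    exact ⟨x, hx, linearIndependent_finCons.2 ⟨hv, hxv⟩⟩
  have hli5 : ∀ v : Fin 4 → L, (∀ i, f (v i) = 0) → LinearIndependent ℝ v →
      LinearIndependent ℝ (Matrix.vecCons T v) := by
    intro v hfv hv
    refine linearIndependent_finCons.2 ⟨hv, fun h => ?_⟩
    have h1 : Submodule.span ℝ (Set.range v) ≤ LinearMap.ker f :=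
      Submodule.span_le.2 (by rintro _ ⟨i, rfl⟩; exact hfv i)
    have h2 : f T = 0 := h1 h
    rw [hT] at h2
    exact one_ne_zero h2
  -- It suffices to find a basis of ker f with two vectors `w` central in ker f and [x₁, x₂] a
  -- multiple of `w 1`; adjoining `T` gives the adapted basis.
  have key : ∀ (x₁ x₂ : L) (w : Fin 2 → L) (c : ℝ), f x₁ = 0 → f x₂ = 0 → (∀ i, f (w i) = 0) →
      (∀ x i, f x = 0 → ⁅x, w i⁆ = 0) → LinearIndependent ℝ ![x₁, x₂, w 0, w 1] →
      ⁅x₁, x₂⁆ = c • w 1 → ∃ (X : Module.Basis (Fin 5) ℝ L) (c : ℝ),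
      (∀ x y : L, X.coord 0 ⁅x, y⁆ = 0) ∧
      ∀ x y : L, ⁅x, y⁆ = X.coord 0 x • ⁅X 0, y⁆ - X.coord 0 y • ⁅X 0, x⁆ +
        (c * (X.coord 1 x * X.coord 2 y - X.coord 1 y * X.coord 2 x)) • X 4 := by
    intro x₁ x₂ w c h1 h2 hw hcw hli hc
    have hli' := hli5 _ (by intro i; fin_cases i; exacts [h1, h2, hw 0, hw 1]) hli
    let X := basisOfLinearIndependentOfCardEqFinrank hli' (by rw [h5, Fintype.card_fin])
    have hX : ⇑X = ![T, x₁, x₂, w 0, w 1] := coe_basisOfLinearIndependentOfCardEqFinrank _ _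
    have hX0 : X 0 = T := congrFun hX 0
    have hX1 : X 1 = x₁ := congrFun hX 1
    have hX2 : X 2 = x₂ := congrFun hX 2
    have hX3 : X 3 = w 0 := congrFun hX 3
    have hX4 : X 4 = w 1 := congrFun hX 4
    have hf0 : f = X.coord 0 := by
      refine X.ext fun i => ?_
      rw [X.coord_apply, X.repr_self]
      fin_cases i
      · simpa [hX0] using hT
      · simpa [hX1] using h1
      · simpa [hX2] using h2
      · simpa [hX3] using hw 0
      · simpa [hX4] using hw 1
    refine ⟨X, c, fun x y => hf0 ▸ hfl x y, fun x y => ?_⟩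
    have hexp : ∀ x, x = X.coord 0 x • T + (X.coord 1 x • x₁ + X.coord 2 x • x₂ +
        X.coord 3 x • w 0 + X.coord 4 x • w 1) := by
      intro x
      conv_lhs => rw [← X.sum_repr x, Fin.sum_univ_five, hX0, hX1, hX2, hX3, hX4]
      simp only [X.coord_apply, add_assoc]
    have hcw' : ∀ x i, f x = 0 → ⁅w i, x⁆ = 0 := fun x i hx => by
      rw [← lie_skew, hcw x i hx, neg_zero]
    have e21 : ⁅x₂, x₁⁆ = -(c • w 1) := by rw [← lie_skew, hc]
    have skew : ∀ v, ⁅v, T⁆ = -⁅T, v⁆ := fun v => (lie_skew v T).symm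
    have hx := hexp x
    have hy := hexp y
    rw [hX0, hX4]
    clear hexp
    generalize X.coord 0 x = a0, X.coord 1 x = a1, X.coord 2 x = a2, X.coord 3 x = a3,
      X.coord 4 x = a4, X.coord 0 y = b0, X.coord 1 y = b1, X.coord 2 y = b2, X.coord 3 y = b3,
      X.coord 4 y = b4 at hx hy ⊢
    subst hx hy
    simp only [lie_add, add_lie, lie_smul, smul_lie, lie_self, skew, hc, e21, hcw _ _ h1,
      hcw _ _ h2, hcw' _ _ h1, hcw' _ _ h2, hcw _ _ (hw _), smul_zero, add_zero, zero_add]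
    module
  obtain ⟨x₂, hx₂, hli3⟩ := hex 2 z (by norm_num) hz
  obtain ⟨x₁, hx₁, hli4⟩ := hex 3 _ (by norm_num) hli3
  have hli4' : ∀ a b c d : ℝ, a • x₁ + b • x₂ + c • z 0 + d • z 1 = 0 →
      a = 0 ∧ b = 0 ∧ c = 0 ∧ d = 0 := by
    intro a b c d h
    have := Fintype.linearIndependent_iff.1 hli4 ![a, b, c, d] (by
      rw [Fin.sum_univ_four]
      exact h)
    exact ⟨this 0, this 1, this 2, this 3⟩
  have hli_of : ∀ w₀ w₁ : L, (∀ a b c d : ℝ, a • x₁ + b • x₂ + c • w₀ + d • w₁ = 0 →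
      a = 0 ∧ b = 0 ∧ c = 0 ∧ d = 0) → LinearIndependent ℝ ![x₁, x₂, w₀, w₁] := by
    intro w₀ w₁ h
    refine Fintype.linearIndependent_iff.2 fun g hg i => ?_
    rw [Fin.sum_univ_four] at hg
    obtain ⟨h0, h1, h2, h3⟩ := h _ _ _ _ hg
    fin_cases i
    exacts [h0, h1, h2, h3]
  obtain ⟨a, b, u, v, hy⟩ : ∃ a b u v : ℝ, ⁅x₁, x₂⁆ = a • x₁ + b • x₂ + (u • z 0 + v • z 1) := by
    have hli' := hli5 ![x₁, x₂, z 0, z 1] (by intro i; fin_cases i; exacts [hx₁, hx₂, hfz 0, hfz 1])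
      (hli_of _ _ hli4')
    let X := basisOfLinearIndependentOfCardEqFinrank hli' (by rw [h5, Fintype.card_fin])
    have hX : ⇑X = ![T, x₁, x₂, z 0, z 1] := coe_basisOfLinearIndependentOfCardEqFinrank _ _
    have h := X.sum_repr ⁅x₁, x₂⁆
    rw [Fin.sum_univ_five, hX] at h
    change X.repr ⁅x₁, x₂⁆ 0 • T + X.repr ⁅x₁, x₂⁆ 1 • x₁ + X.repr ⁅x₁, x₂⁆ 2 • x₂ +
      X.repr ⁅x₁, x₂⁆ 3 • z 0 + X.repr ⁅x₁, x₂⁆ 4 • z 1 = _ at h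
    have h0 := congrArg f h
    simp only [map_add, map_smul, hT, hx₁, hx₂, hfz, hfl, smul_eq_mul, mul_one] at h0
    refine ⟨X.repr ⁅x₁, x₂⁆ 1, X.repr ⁅x₁, x₂⁆ 2, X.repr ⁅x₁, x₂⁆ 3, X.repr ⁅x₁, x₂⁆ 4, ?_⟩
    rw [mul_zero, mul_zero, mul_zero, mul_zero, add_zero, add_zero, add_zero, add_zero] at h0
    rw [h0, zero_smul, zero_add, add_assoc] at h
    exact h.symm
  by_cases h0 : ⁅x₁, x₂⁆ = 0
  · exact key x₁ x₂ z 0 hx₁ hx₂ hfz hcz (hli_of _ _ hli4') (by rw [h0, zero_smul])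
  -- As the `z i` commute with ker f, the bracket [x₁, x₂] is an eigenvector of ad x₁ with
  -- eigenvalue b, and of ad x₂ with eigenvalue -a. Nilpotency makes both zero, so the bracket lies
  -- in the plane of the `z i`.
  have hb : b = 0 := by
    have h1 : ⁅x₁, ⁅x₁, x₂⁆⁆ = b • ⁅x₁, x₂⁆ := by
      conv_lhs => rw [hy]
      simp only [lie_add, lie_smul, lie_self, hcz _ _ hx₁, smul_zero, add_zero, zero_add]
    have h2 := eq_zero_of_lie_eq_smul h1
    rw [h1] at h2
    exact (smul_eq_zero.1 h2).resolve_right h0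
  have ha : a = 0 := by
    have h1 : ⁅x₂, ⁅x₁, x₂⁆⁆ = (-a) • ⁅x₁, x₂⁆ := by
      conv_lhs => rw [hy]
      simp only [lie_add, lie_smul, lie_self, hcz _ _ hx₂, smul_zero, add_zero]
      rw [← lie_skew, smul_neg, neg_smul]
    have h2 := eq_zero_of_lie_eq_smul h1
    rw [h1] at h2
    exact neg_eq_zero.1 ((smul_eq_zero.1 h2).resolve_right h0)
  rw [ha, hb, zero_smul, zero_smul, zero_add, zero_add] at hy
  have hfy := hfl x₁ x₂
  have hcy : ∀ x : L, f x = 0 → ⁅x, ⁅x₁, x₂⁆⁆ = 0 := by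
    intro x hx
    rw [hy, lie_add, lie_smul, lie_smul, hcz _ _ hx, hcz _ _ hx, smul_zero, smul_zero, add_zero]
  -- The nonzero bracket becomes `w 1`, with c = 1, and `w 0` is whichever `z i` is independent of
  -- it.
  by_cases hv : v = 0
  · have hu : u ≠ 0 := by
      rintro rfl
      exact h0 (by rw [hy, hv, zero_smul, zero_smul, add_zero])
    refine key x₁ x₂ ![z 1, ⁅x₁, x₂⁆] 1 hx₁ hx₂ ?_ ?_ (hli_of _ _ ?_) (one_smul _ _).symm
    · intro i
      fin_cases i
      exacts [hfz 1, hfy]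
    · intro x i hx
      fin_cases i
      exacts [hcz _ _ hx, hcy _ hx]
    · intro a b c d h
      have h' : a • x₁ + b • x₂ + (d * u) • z 0 + (c + d * v) • z 1 = 0 := by
        rw [← h]
        change _ = a • x₁ + b • x₂ + c • z 1 + d • ⁅x₁, x₂⁆
        rw [hy]
        module
      obtain ⟨h1, h2, h3, h4⟩ := hli4' _ _ _ _ h'
      have hd : d = 0 := (mul_eq_zero.1 h3).resolve_right hu
      exact ⟨h1, h2, by simpa [hd] using h4, hd⟩
  · refine key x₁ x₂ ![z 0, ⁅x₁, x₂⁆] 1 hx₁ hx₂ ?_ ?_ (hli_of _ _ ?_) (one_smul _ _).symm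
    · intro i
      fin_cases i
      exacts [hfz 0, hfy]
    · intro x i hx
      fin_cases i
      exacts [hcz _ _ hx, hcy _ hx]
    · intro a b c d h
      have h' : a • x₁ + b • x₂ + (c + d * u) • z 0 + (d * v) • z 1 = 0 := by
        rw [← h]
        change _ = a • x₁ + b • x₂ + c • z 0 + d • ⁅x₁, x₂⁆
        rw [hy]
        module
      obtain ⟨h1, h2, h3, h4⟩ := hli4' _ _ _ _ h'
      have hd : d = 0 := (mul_eq_zero.1 h4).resolve_right hv
      exact ⟨h1, h2, by simpa [hd] using h3, hd⟩

end NilpotentLieAlgebra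

end

/-! ### The Chevalley–Eilenberg formula in degrees 1, 3 and 4 -/

noncomputable section

theorem sum_ge_fin_one (F : Fin 1 → Fin 1 → ℝ) : ∑ i, ∑ j ≥ i, F i j = F 0 0 := by
  simp [show Finset.Ici (0 : Fin 1) = {0} by decide]

theorem sum_ge_fin_three (F : Fin 3 → Fin 3 → ℝ) :
    ∑ i, ∑ j ≥ i, F i j = F 0 0 + F 0 1 + F 0 2 + F 1 1 + F 1 2 + F 2 2 := by
  rw [Fin.sum_univ_three, show Finset.Ici (0 : Fin 3) = {0, 1, 2} by decide,
    show Finset.Ici (1 : Fin 3) = {1, 2} by decide, show Finset.Ici (2 : Fin 3) = {2} by decide]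
  simp
  ring

theorem sum_ge_fin_four (F : Fin 4 → Fin 4 → ℝ) :
    ∑ i, ∑ j ≥ i, F i j = F 0 0 + F 0 1 + F 0 2 + F 0 3 + F 1 1 + F 1 2 + F 1 3 + F 2 2 + F 2 3 +
      F 3 3 := by
  rw [Fin.sum_univ_four, show Finset.Ici (0 : Fin 4) = {0, 1, 2, 3} by decide,
    show Finset.Ici (1 : Fin 4) = {1, 2, 3} by decide,
    show Finset.Ici (2 : Fin 4) = {2, 3} by decide, show Finset.Ici (3 : Fin 4) = {3} by decide]
  simp
  ring

namespace MForm

variable {G : Type*} [TopologicalSpace G] [ChartedSpace E5 G] [Group G] [LieGroup (𝓡 5) ∞ G]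

/-- The Maurer–Cartan equation. -/
theorem IsLeftInvariant.d_one_apply_one {α : MForm G 1} (hα : α.IsLeftInvariant)
    (x y : GroupLieAlgebra (𝓡 5) G) : α.d 1 ![x, y] = - α 1 ![⁅x, y⁆] := by
  refine (hα.d_one_apply (k := 0) ![x, y]).trans (congrArg Neg.neg ?_)
  rw [sum_ge_fin_one]
  simp only [Fin.val_zero, add_zero, pow_zero, one_smul]
  refine congrArg (α 1) ?_
  ext i
  fin_cases i
  rfl

theorem IsLeftInvariant.d_one_apply_three {α : MForm G 3} (hα : α.IsLeftInvariant)
    (x : Fin 4 → GroupLieAlgebra (𝓡 5) G) : α.d 1 x =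
      -(α 1 ![⁅x 0, x 1⁆, x 2, x 3] - α 1 ![⁅x 0, x 2⁆, x 1, x 3] + α 1 ![⁅x 0, x 3⁆, x 1, x 2]
        + α 1 ![⁅x 1, x 2⁆, x 0, x 3] - α 1 ![⁅x 1, x 3⁆, x 0, x 2]
        + α 1 ![⁅x 2, x 3⁆, x 0, x 1]) := by
  have hα3 : ∀ f : Fin 3 → GroupLieAlgebra (𝓡 5) G, α 1 f = α 1 ![f 0, f 1, f 2] := fun f =>
    congrArg (α 1) (by ext i; fin_cases i <;> rfl)
  refine (hα.d_one_apply (k := 2) x).trans (congrArg Neg.neg ?_)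
  rw [sum_ge_fin_three]
  rw [hα3 (Matrix.vecCons _ _), hα3 (Matrix.vecCons ⁅x (Fin.castSucc 0), x (Fin.succ 1)⁆ _),
    hα3 (Matrix.vecCons ⁅x (Fin.castSucc 0), x (Fin.succ 2)⁆ _),
    hα3 (Matrix.vecCons ⁅x (Fin.castSucc 1), x (Fin.succ 1)⁆ _),
    hα3 (Matrix.vecCons ⁅x (Fin.castSucc 1), x (Fin.succ 2)⁆ _),
    hα3 (Matrix.vecCons ⁅x (Fin.castSucc 2), x (Fin.succ 2)⁆ _)]
  -- The index j refers to the argument x (j + 1); this shift accounts for the overall minus sign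
  -- relative to the usual exponents.
  change (-1 : ℤ) ^ (0 + 0) • α 1 ![⁅x 0, x 1⁆, x 2, x 3] +
    (-1 : ℤ) ^ (0 + 1) • α 1 ![⁅x 0, x 2⁆, x 1, x 3] +
    (-1 : ℤ) ^ (0 + 2) • α 1 ![⁅x 0, x 3⁆, x 1, x 2] +
    (-1 : ℤ) ^ (1 + 1) • α 1 ![⁅x 1, x 2⁆, x 0, x 3] +
    (-1 : ℤ) ^ (1 + 2) • α 1 ![⁅x 1, x 3⁆, x 0, x 2] +
    (-1 : ℤ) ^ (2 + 2) • α 1 ![⁅x 2, x 3⁆, x 0, x 1] = _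
  simp only [zsmul_eq_mul]
  push_cast
  ring

theorem IsLeftInvariant.d_one_apply_four {α : MForm G 4} (hα : α.IsLeftInvariant)
    (x : Fin 5 → GroupLieAlgebra (𝓡 5) G) : α.d 1 x =
      -(α 1 ![⁅x 0, x 1⁆, x 2, x 3, x 4] - α 1 ![⁅x 0, x 2⁆, x 1, x 3, x 4]
        + α 1 ![⁅x 0, x 3⁆, x 1, x 2, x 4] - α 1 ![⁅x 0, x 4⁆, x 1, x 2, x 3]
        + α 1 ![⁅x 1, x 2⁆, x 0, x 3, x 4] - α 1 ![⁅x 1, x 3⁆, x 0, x 2, x 4]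
        + α 1 ![⁅x 1, x 4⁆, x 0, x 2, x 3] + α 1 ![⁅x 2, x 3⁆, x 0, x 1, x 4]
        - α 1 ![⁅x 2, x 4⁆, x 0, x 1, x 3] + α 1 ![⁅x 3, x 4⁆, x 0, x 1, x 2]) := by
  have hα4 : ∀ f : Fin 4 → GroupLieAlgebra (𝓡 5) G, α 1 f = α 1 ![f 0, f 1, f 2, f 3] := fun f =>
    congrArg (α 1) (by ext i; fin_cases i <;> rfl)
  refine (hα.d_one_apply (k := 3) x).trans (congrArg Neg.neg ?_)
  rw [sum_ge_fin_four]
  rw [hα4 (Matrix.vecCons _ _), hα4 (Matrix.vecCons ⁅x (Fin.castSucc 0), x (Fin.succ 1)⁆ _),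
    hα4 (Matrix.vecCons ⁅x (Fin.castSucc 0), x (Fin.succ 2)⁆ _),
    hα4 (Matrix.vecCons ⁅x (Fin.castSucc 0), x (Fin.succ 3)⁆ _),
    hα4 (Matrix.vecCons ⁅x (Fin.castSucc 1), x (Fin.succ 1)⁆ _),
    hα4 (Matrix.vecCons ⁅x (Fin.castSucc 1), x (Fin.succ 2)⁆ _),
    hα4 (Matrix.vecCons ⁅x (Fin.castSucc 1), x (Fin.succ 3)⁆ _),
    hα4 (Matrix.vecCons ⁅x (Fin.castSucc 2), x (Fin.succ 2)⁆ _),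
    hα4 (Matrix.vecCons ⁅x (Fin.castSucc 2), x (Fin.succ 3)⁆ _),
    hα4 (Matrix.vecCons ⁅x (Fin.castSucc 3), x (Fin.succ 3)⁆ _)]
  change (-1 : ℤ) ^ (0 + 0) • α 1 ![⁅x 0, x 1⁆, x 2, x 3, x 4] +
    (-1 : ℤ) ^ (0 + 1) • α 1 ![⁅x 0, x 2⁆, x 1, x 3, x 4] +
    (-1 : ℤ) ^ (0 + 2) • α 1 ![⁅x 0, x 3⁆, x 1, x 2, x 4] +
    (-1 : ℤ) ^ (0 + 3) • α 1 ![⁅x 0, x 4⁆, x 1, x 2, x 3] +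
    (-1 : ℤ) ^ (1 + 1) • α 1 ![⁅x 1, x 2⁆, x 0, x 3, x 4] +
    (-1 : ℤ) ^ (1 + 2) • α 1 ![⁅x 1, x 3⁆, x 0, x 2, x 4] +
    (-1 : ℤ) ^ (1 + 3) • α 1 ![⁅x 1, x 4⁆, x 0, x 2, x 3] +
    (-1 : ℤ) ^ (2 + 2) • α 1 ![⁅x 2, x 3⁆, x 0, x 1, x 4] +
    (-1 : ℤ) ^ (2 + 3) • α 1 ![⁅x 2, x 4⁆, x 0, x 1, x 3] +
    (-1 : ℤ) ^ (3 + 3) • α 1 ![⁅x 3, x 4⁆, x 0, x 1, x 2] = _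
  simp only [zsmul_eq_mul]
  push_cast
  ring

end MForm

end

/-! ### Closedness from the bracket relations -/

noncomputable section

section

variable {L : Type*} [LieRing L] [LieAlgebra ℝ L] [TopologicalSpace L]

/-- The bracket relations, with respect to a coframe `a`, under which the standard
quadruplet is balanced. -/
structure IsAdapted (a : Fin 5 → L [⋀^Fin 1]→L[ℝ] ℝ) (T : L) (c : ℝ) : Prop where
  apply_zero : ∀ x y : L, a 0 ![⁅x, y⁆] = 0
  apply_lie : ∀ (k : Fin 5) (x y : L), a k ![⁅x, y⁆] =
    a 0 ![x] * a k ![⁅T, y⁆] - a 0 ![y] * a k ![⁅T, x⁆] +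
      (if k = 4 then c else 0) * (a 1 ![x] * a 2 ![y] - a 1 ![y] * a 2 ![x])

variable {a : Fin 5 → L [⋀^Fin 1]→L[ℝ] ℝ} {T : L} {c : ℝ}

theorem wedge_two_one_apply_vec (A : L [⋀^Fin 2]→L[ℝ] ℝ) (b : L [⋀^Fin 1]→L[ℝ] ℝ) (x y z : L) :
    wedge A b ![x, y, z] = A ![x, y] * b ![z] - A ![x, z] * b ![y] + A ![y, z] * b ![x] :=
  wedge_two_one_apply A b ![x, y, z]

theorem wedge_two_two_apply_vec (A B : L [⋀^Fin 2]→L[ℝ] ℝ) (x y z w : L) :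
    wedge A B ![x, y, z, w] = A ![x, y] * B ![z, w] - A ![x, z] * B ![y, w]
      + A ![x, w] * B ![y, z] + A ![y, z] * B ![x, w]
      - A ![y, w] * B ![x, z] + A ![z, w] * B ![x, y] :=
  wedge_two_two_apply A B ![x, y, z, w]

/-- Wedging with a⁰ removes every term containing ad T. What remains is a multiple of a¹² replacing
a⁴ in a⁴² or a¹⁴, which vanishes. In ω₃ the partner of a⁴ is a³, so the argument fails for i = 2. -/
theorem IsAdapted.chevalleyEilenberg_omega_eta (h : IsAdapted a T c) {i : Fin 3} (hi : i ≠ 2)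
    (x y z w : L) :
    wedge (stdTriple a i) (a 0) ![⁅x, y⁆, z, w] - wedge (stdTriple a i) (a 0) ![⁅x, z⁆, y, w]
      + wedge (stdTriple a i) (a 0) ![⁅x, w⁆, y, z] + wedge (stdTriple a i) (a 0) ![⁅y, z⁆, x, w]
      - wedge (stdTriple a i) (a 0) ![⁅y, w⁆, x, z]
      + wedge (stdTriple a i) (a 0) ![⁅z, w⁆, x, y] = 0 := by
  have h0 := h.apply_zero
  have h1 : ∀ x y : L, _ := h.apply_lie 1
  have h2 : ∀ x y : L, _ := h.apply_lie 2
  have h3 : ∀ x y : L, _ := h.apply_lie 3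
  have h4 : ∀ x y : L, _ := h.apply_lie 4
  have hc1 : (if (1 : Fin 5) = 4 then c else 0) = 0 := rfl
  have hc2 : (if (2 : Fin 5) = 4 then c else 0) = 0 := rfl
  have hc3 : (if (3 : Fin 5) = 4 then c else 0) = 0 := rfl
  have hc4 : (if (4 : Fin 5) = 4 then c else 0) = c := rfl
  rw [hc1] at h1
  rw [hc2] at h2
  rw [hc3] at h3
  rw [hc4] at h4
  simp only [wedge_two_one_apply_vec]
  fin_cases i
  · simp only [Fin.zero_eta, stdTriple_zero_apply, h0]
    rw [h1 x y, h1 x z, h1 x w, h1 y z, h1 y w, h1 z w, h2 x y, h2 x z, h2 x w, h2 y z, h2 y w,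
      h2 z w, h3 x y, h3 x z, h3 x w, h3 y z, h3 y w, h3 z w, h4 x y, h4 x z, h4 x w, h4 y z,
      h4 y w, h4 z w]
    ring
  · simp only [Fin.mk_one, stdTriple_one_apply, h0]
    rw [h1 x y, h1 x z, h1 x w, h1 y z, h1 y w, h1 z w, h2 x y, h2 x z, h2 x w, h2 y z, h2 y w,
      h2 z w, h3 x y, h3 x z, h3 x w, h3 y z, h3 y w, h3 z w, h4 x y, h4 x z, h4 x w, h4 y z,
      h4 y w, h4 z w]
    ring
  · exact absurd rfl hi

/-- If `X` is the basis dual to `a`, then the form is the trace of `ad X₀` up to a factor. -/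
theorem IsAdapted.chevalleyEilenberg_omega_omega {X : Fin 5 → L} (h : IsAdapted a (X 0) c)
    (hX : ∀ i j, a i ![X j] = if i = j then 1 else 0)
    (htr : ∑ k, a k ![⁅X 0, X k⁆] = 0) {W : L [⋀^Fin 4]→L[ℝ] ℝ}
    (hW : W = wedge (k := 2) (l := 2) (stdTriple a 2) (stdTriple a 2)) :
    W ![⁅X 0, X 1⁆, X 2, X 3, X 4] - W ![⁅X 0, X 2⁆, X 1, X 3, X 4]
        + W ![⁅X 0, X 3⁆, X 1, X 2, X 4] - W ![⁅X 0, X 4⁆, X 1, X 2, X 3]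
        + W ![⁅X 1, X 2⁆, X 0, X 3, X 4] - W ![⁅X 1, X 3⁆, X 0, X 2, X 4]
        + W ![⁅X 1, X 4⁆, X 0, X 2, X 3] + W ![⁅X 2, X 3⁆, X 0, X 1, X 4]
        - W ![⁅X 2, X 4⁆, X 0, X 1, X 3] + W ![⁅X 3, X 4⁆, X 0, X 1, X 2] = 0 := by
  rw [Fin.sum_univ_five, h.apply_zero, zero_add] at htr
  have hW' : ∀ x y z w : L, W ![x, y, z, w] = _ := fun x y z w =>
    (congrArg (fun W' : L [⋀^Fin 4]→L[ℝ] ℝ => W' ![x, y, z, w]) hW).trans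
      (wedge_two_two_apply_vec (stdTriple a 2) (stdTriple a 2) x y z w)
  simp only [hW', stdTriple_two_apply, hX]
  simp
  -- Terms with X₀ as a separate argument vanish because ω₃ involves only a¹, …, a⁴. The other four
  -- sum to the trace times 2, the value of ω₃ ∧ ω₃ on X₁, …, X₄.
  linear_combination 2 * htr

end

end

/-! ### Dual bases, adapted coframes and the conclusion -/

noncomputable section

section

variable {L : Type*} [AddCommGroup L] [Module ℝ L] [TopologicalSpace L]

/-- The linear functional underlying an alternating one-form. -/
def oneFormToDual (L : Type*) [AddCommGroup L] [Module ℝ L] [TopologicalSpace L] :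
    (L [⋀^Fin 1]→L[ℝ] ℝ) →ₗ[ℝ] Module.Dual ℝ L where
  toFun a := ((ContinuousAlternatingMap.ofSubsingleton ℝ L ℝ (0 : Fin 1)).symm a : L →L[ℝ] ℝ)
  map_add' _ _ := rfl
  map_smul' _ _ := rfl

theorem oneFormToDual_apply (a : L [⋀^Fin 1]→L[ℝ] ℝ) (v : L) : oneFormToDual L a v = a ![v] :=
  congrArg a (funext fun i => by fin_cases i; rfl)

theorem oneFormToDual_injective : Function.Injective (oneFormToDual L) := by
  intro a b h
  ext v
  rw [apply_fin_one a, apply_fin_one b]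
  rw [← oneFormToDual_apply, ← oneFormToDual_apply, h]

theorem apply_eq_coord {a : Fin 5 → L [⋀^Fin 1]→L[ℝ] ℝ} {X : Module.Basis (Fin 5) ℝ L}
    (hX : ∀ i j, a i ![X j] = if i = j then 1 else 0) (i : Fin 5) (v : L) :
    a i ![v] = X.coord i v := by
  have h : oneFormToDual L (a i) = X.coord i := X.ext fun j => by
    rw [oneFormToDual_apply, hX, X.coord_apply, X.repr_self, Finsupp.single_apply]
    simp only [eq_comm]
  rw [← oneFormToDual_apply, h]

theorem exists_dual_basis [FiniteDimensional ℝ L] (h5 : Module.finrank ℝ L = 5)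
    {a : Fin 5 → L [⋀^Fin 1]→L[ℝ] ℝ} (ha : LinearIndependent ℝ a) :
    ∃ X : Module.Basis (Fin 5) ℝ L, ∀ i j, a i ![X j] = if i = j then 1 else 0 := by
  have hli : LinearIndependent ℝ (fun i => oneFormToDual L (a i)) :=
    ha.map' (oneFormToDual L) (LinearMap.ker_eq_bot.2 oneFormToDual_injective)
  let b := basisOfLinearIndependentOfCardEqFinrank hli (by
    rw [Subspace.dual_finrank_eq, h5, Fintype.card_fin])
  refine ⟨b.dualBasis.map (Module.evalEquiv ℝ L).symm, fun i j => ?_⟩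
  have h1 : oneFormToDual L (a i) = b i := by
    rw [coe_basisOfLinearIndependentOfCardEqFinrank]
  rw [← oneFormToDual_apply, h1, Module.Basis.map_apply]
  have h2 := LinearMap.congr_fun ((Module.evalEquiv ℝ L).apply_symm_apply (b.dualBasis j)) (b i)
  rw [Module.evalEquiv_apply] at h2
  refine h2.trans ?_
  rw [b.dualBasis_apply_self]

end

variable {G : Type*} [TopologicalSpace G] [ChartedSpace E5 G] [Group G] [LieGroup (𝓡 5) ∞ G]

instance finiteDimensional_groupLieAlgebra : FiniteDimensional ℝ (GroupLieAlgebra (𝓡 5) G) :=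
  inferInstanceAs (FiniteDimensional ℝ E5)

omit [LieGroup (𝓡 5) ∞ G] in
theorem finrank_groupLieAlgebra : Module.finrank ℝ (GroupLieAlgebra (𝓡 5) G) = 5 :=
  finrank_euclideanSpace_fin (𝕜 := ℝ) (n := 5)

/-- The coframe descends, and each closedness condition on `N` is checked on the lift at the
identity of `G`, where it is one of the two algebraic identities for `IsAdapted`. -/
theorem IsCompactNilmanifold.exists_balanced {N : Type*} [TopologicalSpace N] [ChartedSpace E5 N]
    [IsManifold (𝓡 5) ∞ N] {Γ : Subgroup G} {π : G → N} (hN : IsCompactNilmanifold Γ π)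
    {e : Fin 5 → MForm G 1} (he : ∀ i, (e i).IsLeftInvariant)
    {X : Module.Basis (Fin 5) ℝ (GroupLieAlgebra (𝓡 5) G)}
    (hX : ∀ i j, e i 1 ![X j] = if i = j then 1 else 0) {c : ℝ}
    (h : IsAdapted (fun k => e k 1) (X 0) c) :
    ∃ e' : Fin 5 → MForm N 1, (∀ i, (e' i).pullback π = e i) ∧
      (stdEta e').IsInvariant π ∧ (∀ i, (stdOmega e' i).IsInvariant π) ∧
      IsBalancedSU2Structure (stdEta e') (stdOmega e') := by
  have hnil := hN.nilpotent
  choose e' he' using fun i => hN.exists_pullback_eq (he i)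
  have hη : (stdEta e').pullback π = stdEta e := he' 0
  have hω : ∀ i, (stdOmega e' i).pullback π = stdOmega e i := fun i => by
    rw [MForm.pullback_stdOmega]
    exact congrArg (fun e => stdOmega e i) (funext he')
  have hωl := MForm.isLeftInvariant_stdOmega he
  have hηi : (stdEta e').IsInvariant π := by
    rw [MForm.IsInvariant, hη]
    exact he 0
  have hωi : ∀ i, (stdOmega e' i).IsInvariant π := fun i => by
    rw [MForm.IsInvariant, hω]
    exact hωl i
  have htr : ∑ k, e k 1 ![⁅X 0, X k⁆] = 0 := by
    have h1 := trace_ad_eq_zero (X 0)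
    rw [LinearMap.trace_eq_matrix_trace ℝ X, Matrix.trace] at h1
    refine Eq.trans (Finset.sum_congr rfl fun k _ => ?_) h1
    rw [Matrix.diag_apply, LinearMap.toMatrix_apply, LieAlgebra.ad_apply]
    exact apply_eq_coord (a := fun k => e k 1) hX k _
  have hd1 : ∀ i : Fin 3, i ≠ 2 → ((stdOmega e' i).wedge (stdEta e')).d = 0 := by
    intro i hi
    have hp : ((stdOmega e' i).wedge (stdEta e')).pullback π = (stdOmega e i).wedge (stdEta e) := by
      rw [MForm.pullback_wedge, hω, hη]
    have hl : ((stdOmega e i).wedge (stdEta e)).IsLeftInvariant := (hωl i).wedge (he 0)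
    have hv : (stdOmega e i).wedge (stdEta e) 1 = wedge (stdTriple (fun k => e k 1) i) (e 0 1) := by
      fin_cases i <;> rfl
    refine hN.d_eq_zero (by rw [MForm.IsInvariant, hp]; exact hl) ?_
    rw [hp]
    ext v
    refine (hl.d_one_apply_three v).trans ?_
    rw [hv]
    exact neg_eq_zero.2 (h.chevalleyEilenberg_omega_eta hi (v 0) (v 1) (v 2) (v 3))
  have hd2 : ((stdOmega e' 2).wedge (stdOmega e' 2)).d = 0 := by
    have hp : ((stdOmega e' 2).wedge (stdOmega e' 2)).pullback π =
        (stdOmega e 2).wedge (stdOmega e 2) := by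
      rw [MForm.pullback_wedge, hω]
    have hl : ((stdOmega e 2).wedge (stdOmega e 2)).IsLeftInvariant := (hωl 2).wedge (hωl 2)
    refine hN.d_eq_zero (by rw [MForm.IsInvariant, hp]; exact hl) ?_
    rw [hp]
    -- The degree equals the dimension, so evaluation on the single basis `X` suffices.
    have h0 : (((stdOmega e 2).wedge (stdOmega e 2)).d 1).toAlternatingMap = 0 := by
      rw [← AlternatingMap.map_basis_eq_zero_iff X]
      refine (MForm.IsLeftInvariant.d_one_apply_four hl X).trans ?_
      exact neg_eq_zero.2 (h.chevalleyEilenberg_omega_omega hX htr rfl)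
    ext v
    exact congrArg (fun f => f v) h0
  refine ⟨e', he', hηi, hωi, ⟨isSU2Structure_std (hN.isSmooth hηi) (fun i => hN.isSmooth (hωi i)) ?_,
    hd1 0 (by decide), hd1 1 (by decide), hd2⟩⟩
  intro x
  obtain ⟨g, rfl⟩ := hN.surjective x
  -- The frame dual to the descended coframe is the image under dπ of the left-invariant frame.
  refine ⟨fun j => hN.dEquiv g (mulInvariantVectorField (X j) g), fun i j => ?_⟩
  have h1 := (he i).apply_mulInvariantVectorField g ![X j]
  rw [hX] at h1
  refine Eq.trans ?_ h1
  have h2 := congrArg (fun α : MForm G 1 =>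
    α g (fun k => mulInvariantVectorField ((![X j] : Fin 1 → _) k) g)) (he' i)
  refine Eq.trans ?_ h2
  refine congrArg (e' i (π g)) ?_
  ext k
  fin_cases k
  rfl

theorem MForm.d_one_eq {e : MForm G 1} (he : e.IsLeftInvariant) {β : MForm G 2} (h : e.d = β)
    (x y : GroupLieAlgebra (𝓡 5) G) : e 1 ![⁅x, y⁆] = - β 1 ![x, y] := by
  rw [← h, he.d_one_apply_one, neg_neg]

/-- Since eᵏ([x, y]) = -deᵏ(x, y), the constant c is minus the coefficient of `(e 1).wedge (e 2)` in
`(e 4).d`: 0 in the first case and -1 in the other two. All other terms of the differentials contain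
`e 0`. -/
theorem isAdapted_of_structureEquations {e : Fin 5 → MForm G 1} (he : ∀ i, (e i).IsLeftInvariant)
    {T : GroupLieAlgebra (𝓡 5) G} (hT : ∀ i, e i 1 ![T] = if i = 0 then 1 else 0)
    (h : StructureEquationsA e ∨ StructureEquationsB e ∨ StructureEquationsC e) :
    ∃ c : ℝ, IsAdapted (fun k => e k 1) T c := by
  have hz : ∀ x y : GroupLieAlgebra (𝓡 5) G, (0 : MForm G 2) 1 ![x, y] = 0 := fun _ _ => rfl
  have hw : ∀ i j (x y : GroupLieAlgebra (𝓡 5) G), ((e i).wedge (e j)) 1 ![x, y] =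
      e i 1 ![x] * e j 1 ![y] - e i 1 ![y] * e j 1 ![x] := fun i j x y =>
    wedge_one_one_apply (e i 1) (e j 1) ![x, y]
  have hT0 : e 0 1 ![T] = 1 := hT 0
  have hT1 : e 1 1 ![T] = 0 := hT 1
  have hT2 : e 2 1 ![T] = 0 := hT 2
  have hT3 : e 3 1 ![T] = 0 := hT 3
  rcases h with ⟨h0, h1, h2, h3, h4⟩ | ⟨h0, h1, h2, h3, h4⟩ | ⟨h0, h1, h2, h3, h4⟩
  · refine ⟨0, fun x y => ?_, fun k x y => ?_⟩
    · rw [MForm.d_one_eq (he 0) h0, hz, neg_zero]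
    · fin_cases k <;>
        simp [MForm.d_one_eq (he 0) h0, MForm.d_one_eq (he 1) h1, MForm.d_one_eq (he 2) h2,
          MForm.d_one_eq (he 3) h3, MForm.d_one_eq (he 4) h4, hw, hT0, hT1, hT3]
      all_goals ring
  · refine ⟨-1, fun x y => ?_, fun k x y => ?_⟩
    · rw [MForm.d_one_eq (he 0) h0, hz, neg_zero]
    · fin_cases k <;>
        simp [MForm.d_one_eq (he 0) h0, MForm.d_one_eq (he 1) h1, MForm.d_one_eq (he 2) h2,
          MForm.d_one_eq (he 3) h3, MForm.d_one_eq (he 4) h4, hw, hT0, hT1, hT2]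
      all_goals ring
  · refine ⟨-1, fun x y => ?_, fun k x y => ?_⟩
    · rw [MForm.d_one_eq (he 0) h0, hz, neg_zero]
    · fin_cases k <;>
        simp [MForm.d_one_eq (he 0) h0, MForm.d_one_eq (he 1) h1, MForm.d_one_eq (he 2) h2,
          MForm.d_one_eq (he 3) h3, MForm.d_one_eq (he 4) h4, hw, hT0, hT1, hT2, hT3]
      all_goals ring

/-- Every five-dimensional nilpotent Lie group has a left-invariant coframe that is adapted. -/
theorem exists_isAdapted (hnil : LieRing.IsNilpotent (GroupLieAlgebra (𝓡 5) G)) :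
    ∃ (e : Fin 5 → MForm G 1) (X : Module.Basis (Fin 5) ℝ (GroupLieAlgebra (𝓡 5) G)) (c : ℝ),
      (∀ i, (e i).IsLeftInvariant) ∧ (∀ i j, e i 1 ![X j] = if i = j then 1 else 0) ∧
      IsAdapted (fun k => e k 1) (X 0) c := by
  obtain ⟨X, c, h0, hb⟩ := exists_adapted_basis (L := GroupLieAlgebra (𝓡 5) G)
    finrank_groupLieAlgebra
  let f : Fin 5 → E5 →L[ℝ] ℝ := fun k =>
    LinearMap.toContinuousLinearMap (E := E5) (F' := ℝ) (X.coord k)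
  let e : Fin 5 → MForm G 1 := fun k =>
    MForm.leftInvariant G (ContinuousAlternatingMap.ofSubsingleton ℝ E5 ℝ (0 : Fin 1) (f k))
  have he : ∀ k (v : GroupLieAlgebra (𝓡 5) G), e k 1 ![v] = X.coord k v := by
    intro k v
    have h1 : e k 1 = ContinuousAlternatingMap.ofSubsingleton ℝ E5 ℝ (0 : Fin 1) (f k) :=
      MForm.leftInvariant_one _
    rw [h1]
    rfl
  have heX : ∀ i j, e i 1 ![X j] = if i = j then 1 else 0 := by
    intro i j
    rw [he, X.coord_apply, X.repr_self, Finsupp.single_apply]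
    simp only [eq_comm]
  refine ⟨e, X, c, fun i => MForm.isLeftInvariant_leftInvariant _, heX, fun x y => ?_,
    fun k x y => ?_⟩
  · rw [he]
    exact h0 x y
  · simp only [he]
    conv_lhs => rw [hb x y]
    rw [map_add, map_sub, map_smul, map_smul, map_smul]
    have h4 : X.coord k (X 4) = if k = 4 then 1 else 0 := (he k _).symm.trans (heX k 4)
    rw [h4]
    simp only [smul_eq_mul]
    split_ifs <;> ring

end

theorem proposition2p4
    {G : Type*} [TopologicalSpace G] [ChartedSpace E5 G] [Group G] [LieGroup (𝓡 5) ∞ G]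
    {N : Type*} [TopologicalSpace N] [ChartedSpace E5 N] [IsManifold (𝓡 5) ∞ N]
    (Γ : Subgroup G) (π : G → N) (hN : IsCompactNilmanifold Γ π) :
    (∃ (η : MForm N 1) (w : Fin 3 → MForm N 2),
      η.IsInvariant π ∧ (∀ i, (w i).IsInvariant π) ∧ IsBalancedSU2Structure η w) ∧
    ∀ e : Fin 5 → MForm G 1, IsLeftInvariantCoframe e →
      (StructureEquationsA e ∨ StructureEquationsB e ∨ StructureEquationsC e) →
      ∃ e' : Fin 5 → MForm N 1, (∀ i, (e' i).pullback π = e i) ∧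
        (stdEta e').IsInvariant π ∧ (∀ i, (stdOmega e' i).IsInvariant π) ∧
        IsBalancedSU2Structure (stdEta e') (stdOmega e') := by
  constructor
  · obtain ⟨e, X, c, he, hX, h⟩ := exists_isAdapted hN.nilpotent
    obtain ⟨e', -, h1, h2, h3⟩ := hN.exists_balanced he hX h
    exact ⟨_, _, h1, h2, h3⟩
  · intro e he hs
    obtain ⟨X, hX⟩ := exists_dual_basis (L := GroupLieAlgebra (𝓡 5) G)
      finrank_groupLieAlgebra he.linearIndependent
    obtain ⟨c, h⟩ := isAdapted_of_structureEquations he.leftInvariant (fun i => hX i 0) hs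
    exact hN.exists_balanced he.leftInvariant hX h
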